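/- Let $c>1$ be a constant. There are constants $0<\alpha<1<\beta$, depending only on $c$, such that the following holds. Let $d=d(n)$ satisfy $c\log n\le d\le \log^5 n$ for all sufficiently large $n$, and let $G=G(n,p)$ be the binomial random graph on $n$ vertices with $p=d/n$. Let $t^*=t^*(n)$ be the largest integer sequence with $d^{t^*}=o(n)$ (that is, $d^{t^*}=o(n)$, and every integer sequence $s=s(n)$ with $d^{s}=o(n)$ satisfies $s\le t^*$ for all large $n$); we assume that such a sequence exists. Put $\gamma=\gamma(n)=p\,d^{t^*}=d^{t^*+1}/n$. For a vertex $w$ and an integer $t \ge 0$ let $V_t(w)$ be the set of vertices at distance exactly $t$ from $w$. "W.h.p." means with probability tending to $1$ as $n\to\infty$, and the $o(1)$ terms are uniform in $w$ and $t$. The constants $\alpha,\beta$ are such that w.h.p. for all vertices $w$ and all $1\le t\le t^*$ $$(1-o(1))\,\alpha d^t\le |V_t(w)|\le (1+o(1))\,\beta d^t$$ (for $t=1$ this reads $(1-o(1))\alpha d\le\deg w\le(1+o(1))\beta d$), and: **Case 1:** if $\gamma=\Theta(1)$, then w.h.p. for all vertices $w$ $$1-e^{-\alpha\gamma}-o(1)\le\frac{|V_{t^*+1}(w)|}{n}\le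 1-e^{-\beta\gamma}+o(1),$$ $$e^{-\beta\gamma}-o(1)\le\frac{|V_{t^*+2}(w)|}{n}\le e^{-\alpha\gamma}+o(1),$$ $$\frac{|V_{t^*+1}(w)|}{n}+\frac{|V_{t^*+2}(w)|}{n}=1-o(1).$$ **Case 2:** if $\gamma=\omega(1)$, then w.h.p. for all vertices $w$ $$\frac{|V_{t^*+1}(w)|}{n}\ge 1-(1+o(1))\left(\frac{\beta\gamma}{d}+e^{-\alpha\gamma}\right).$$ Moreover, if $d=\omega(\log n)$, then the shell-growth bound and Case 1 hold with $\alpha=\beta=1$, and Case 2 holds with $\beta=1$ and every constant $0<\alpha<1$. -/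

import Mathlib

open Filter Topology Asymptotics

namespace RandomShells

/-- The real number `x` as an edge probability. It is `x` itself when `0 ≤ x ≤ 1`, and is
truncated to `[0, 1]` otherwise (for `x = d / n` this matters for finitely many `n` only). -/
noncomputable def edgeProb (x : ℝ) : unitInterval :=
  Set.projIcc 0 1 zero_le_one x

/-- The event `E n` has probability tending to `1` in `G(n, p)` with `p = d n / n`, that is,
`E` holds with high probability. -/
def WHP (d : ℕ → ℝ) (E : (n : ℕ) → SimpleGraph (Fin n) → Prop) : Prop :=
  Tendsto
    (fun n : ℕ =>
      (SimpleGraph.binomialRandom (Fin n) (edgeProb (d n / (n : ℝ)))).real {G | E n G})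
    atTop (𝓝 1)

/-- The shell `V_t(w)`: the vertices at distance exactly `t` from `w`. The distance is the
extended one, so vertices in other components lie in no shell. -/
def shell {V : Type*} (G : SimpleGraph V) (w : V) (t : ℕ) : Set V :=
  {v | G.edist v w = (t : ℕ∞)}

/-- The fraction `|V_t(w)| / n` of the vertices that lie in the shell `V_t(w)`. -/
noncomputable def shellFraction {n : ℕ} (G : SimpleGraph (Fin n)) (w : Fin n) (t : ℕ) : ℝ :=
  ((shell G w t).ncard : ℝ) / (n : ℝ)

/-- `t = t(n)` is the largest integer sequence such that `d ^ t = o(n)`: it has this property, and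
every other sequence with this property is eventually at most `t`. -/
def IsLargestExponent (d : ℕ → ℝ) (t : ℕ → ℕ) : Prop :=
  ((fun n : ℕ => d n ^ t n) =o[atTop] fun n : ℕ => (n : ℝ)) ∧
    ∀ s : ℕ → ℕ, ((fun n : ℕ => d n ^ s n) =o[atTop] fun n : ℕ => (n : ℝ)) →
      ∀ᶠ n in atTop, s n ≤ t n

/-- `γ(n) = p d ^ t = d ^ (t + 1) / n`. -/
noncomputable def gam (d : ℕ → ℝ) (t : ℕ → ℕ) (n : ℕ) : ℝ :=
  d n ^ (t n + 1) / (n : ℝ)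

/-- W.h.p. `(1 - o(1)) α d ^ s ≤ |V_s(w)| ≤ (1 + o(1)) β d ^ s` for all vertices `w` and all
`1 ≤ s ≤ t`. For `s = 1` this is the bound `(1 - o(1)) α d ≤ deg w ≤ (1 + o(1)) β d`. -/
def ShellGrowth (α β : ℝ) (d : ℕ → ℝ) (t : ℕ → ℕ) : Prop :=
  ∀ ε : ℝ, 0 < ε → WHP d fun n G => ∀ w : Fin n, ∀ s : ℕ, 1 ≤ s → s ≤ t n →
    (1 - ε) * α * d n ^ s ≤ ((shell G w s).ncard : ℝ) ∧
      ((shell G w s).ncard : ℝ) ≤ (1 + ε) * β * d n ^ s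

/-- W.h.p., for all vertices `w`, up to errors `o(1)` that are uniform in `w`, the shells
`V_{t+1}(w)` and `V_{t+2}(w)` have fractions in `[1 - e^{-αγ}, 1 - e^{-βγ}]` and
`[e^{-βγ}, e^{-αγ}]` respectively, and these two fractions add up to `1`. -/
def TwoLastShells (α β : ℝ) (d : ℕ → ℝ) (t : ℕ → ℕ) : Prop :=
  ∀ ε : ℝ, 0 < ε → WHP d fun n G => ∀ w : Fin n,
    (1 - Real.exp (-(α * gam d t n)) - ε ≤ shellFraction G w (t n + 1) ∧
      shellFraction G w (t n + 1) ≤ 1 - Real.exp (-(β * gam d t n)) + ε) ∧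
    (Real.exp (-(β * gam d t n)) - ε ≤ shellFraction G w (t n + 2) ∧
      shellFraction G w (t n + 2) ≤ Real.exp (-(α * gam d t n)) + ε) ∧
    |shellFraction G w (t n + 1) + shellFraction G w (t n + 2) - 1| ≤ ε

/-- W.h.p. `|V_{t+1}(w)| / n ≥ 1 - (1 + o(1)) (βγ / d + e^{-αγ})` for all vertices `w`. -/
def OneLastShell (α β : ℝ) (d : ℕ → ℝ) (t : ℕ → ℕ) : Prop :=
  ∀ ε : ℝ, 0 < ε → WHP d fun n G => ∀ w : Fin n,
    1 - (1 + ε) * (β * gam d t n / d n + Real.exp (-(α * gam d t n))) ≤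
      shellFraction G w (t n + 1)

end RandomShells

/-! Explore the graph from `w` by breadth-first search. The event that the open ball is `A` and the
shell is `S` involves only edges meeting `A`, while the next shell is decided by edges between `S`
and the unexplored vertices. These edge sets are disjoint, so given the exploration the next shell
is binomial with `n - |A| - |S|` trials of success probability `1 - (1 - p) ^ |S|`
(`measureReal_shell_succ_le`, `iIndepSet_attached`). A Chernoff bound and a union over all `w` and
all radii put every shell close to its conditional mean w.h.p. (`whp_concentrated`). Apart from the
lower bound on degrees, the rest is deterministic on that event.

While shells are small, a step multiplies the size by `d` up to a relative error `O(d ^ (r + 1) / n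
+ d ^ (-r / 2))`. These errors form geometric series with sum `o(1)`, so the constants of the first
shell survive up to `t` (`Concentrated.shell_growth`). For degrees, `d ≥ c log n` with `c > 1` makes
the lower tail beat the union over `n` vertices for some `α > 0` (`exists_firstShell`); if `d =
ω(log n)`, degrees are `(1 + o(1)) d` (`firstShell_one`).

At the end `p |V_t|` lies between about `αγ` and `βγ`, and a vertex is missed by the next shell with
probability about `exp (-p |V_t|)`. If `γ = Θ(1)`, then `V_{t+1}` is linear in `n`, so `p |V_{t+1}|
→ ∞` and `V_{t+2}` takes nearly all the rest. If `γ → ∞`, what is missing from `V_{t+1}` is the ball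
already explored, a fraction of about `βγ / d` at most, and the missed vertices. -/

namespace RandomShells

open MeasureTheory ProbabilityTheory

/-! ### Independence of events on disjoint edge sets -/

section EdgeIndependence

variable {V : Type*}

/-- An event on graphs that depends only on the edges in `I`. -/
def DependsOnEdges (I : Set (Sym2 V)) (E : Set (SimpleGraph V)) : Prop :=
  ∀ G G' : SimpleGraph V, (∀ e ∈ I, e ∈ G.edgeSet ↔ e ∈ G'.edgeSet) → G ∈ E → G' ∈ E

lemma DependsOnEdges.compl {I : Set (Sym2 V)} {E : Set (SimpleGraph V)} (h : DependsOnEdges I E) :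
    DependsOnEdges I Eᶜ :=
  fun G G' hGG' hG hG' => hG (h G' G (fun e he => (hGG' e he).symm) hG')

lemma DependsOnEdges.inter {I J : Set (Sym2 V)} {E F : Set (SimpleGraph V)}
    (hE : DependsOnEdges I E) (hF : DependsOnEdges J F) : DependsOnEdges (I ∪ J) (E ∩ F) :=
  fun G G' hGG' hG => ⟨hE G G' (fun e he => hGG' e (.inl he)) hG.1,
    hF G G' (fun e he => hGG' e (.inr he)) hG.2⟩

variable [Fintype V]

/-- As there are finitely many graphs, this makes every event measurable, which is what
`.of_discrete` uses throughout. -/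
instance : MeasurableSingletonClass (SimpleGraph V) where
  measurableSet_singleton G := by
    classical
    have h := SimpleGraph.measurable_edgeSet (V := V) (MeasurableSet.of_discrete (s := {G.edgeSet}))
    convert h using 1
    ext H
    simp

/-- The edge indicators of `G(V, p)` have the product law. -/
lemma map_mem_edgeSet_binomialRandom (p : unitInterval) :
    (SimpleGraph.binomialRandom V p).map (fun G (e : Sym2 V) => e ∈ G.edgeSet) =
      Measure.infinitePi fun e : Sym2 V =>
        (unitInterval.toNNReal p • Measure.dirac (e ∈ (Sym2.diagSetᶜ : Set (Sym2 V)))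
          + unitInterval.toNNReal (unitInterval.symm p) • Measure.dirac False : Measure Prop) := by
  have h1 : (fun (G : SimpleGraph V) (e : Sym2 V) => e ∈ G.edgeSet) =
      (fun (s : Set (Sym2 V)) e => e ∈ s) ∘ SimpleGraph.edgeSet := rfl
  have hm : Measurable (fun (s : Set (Sym2 V)) (e : Sym2 V) => e ∈ s) := by fun_prop
  have h2 : (SimpleGraph.binomialRandom V p).map SimpleGraph.edgeSet =
      setBernoulli (Sym2.diagSetᶜ : Set (Sym2 V)) p := by
    -- Mapping a comap back restricts the measure to the range of `edgeSet`. This loses nothing,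
    -- since the random edge set almost surely avoids the diagonal.
    rw [SimpleGraph.binomialRandom, SimpleGraph.measurableEmbedding_edgeSet.map_comap]
    refine Measure.restrict_eq_self_of_ae_mem ?_
    filter_upwards [setBernoulli_ae_subset] with s hs
    exact ⟨.fromEdgeSet s, by simpa [← Set.disjoint_compl_right_iff_subset] using hs⟩
  rw [h1, ← Measure.map_map hm SimpleGraph.measurable_edgeSet, h2, setBernoulli_eq_map,
    Measure.map_map hm (by fun_prop)]
  exact Measure.map_id

lemma iIndepFun_mem_edgeSet (p : unitInterval) :
    iIndepFun (fun (e : Sym2 V) (G : SimpleGraph V) => e ∈ G.edgeSet)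
      (SimpleGraph.binomialRandom V p) := by
  classical
  have hm : ∀ e : Sym2 V, Measurable fun G : SimpleGraph V => e ∈ G.edgeSet := fun e => .of_discrete
  rw [iIndepFun_iff_map_fun_eq_infinitePi_map hm, map_mem_edgeSet_binomialRandom]
  congr 1
  funext e
  have := map_mem_edgeSet_binomialRandom (V := V) p
  have h3 := congrArg (Measure.map (fun f : Sym2 V → Prop => f e)) this
  rw [Measure.map_map (by fun_prop) .of_discrete, Measure.infinitePi_map_eval] at h3
  exact h3.symm

lemma binomialRandom_real_edge (p : unitInterval) {e : Sym2 V} (he : ¬ e.IsDiag) :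
    (SimpleGraph.binomialRandom V p).real {G | e ∈ G.edgeSet} = p := by
  have h3 := congrArg (Measure.map (fun f : Sym2 V → Prop => f e))
    (map_mem_edgeSet_binomialRandom (V := V) p)
  rw [Measure.map_map (by fun_prop) .of_discrete, Measure.infinitePi_map_eval] at h3
  have h4 := congrArg (fun m : Measure Prop => m.real {True}) h3
  rw [map_measureReal_apply .of_discrete .of_discrete] at h4
  have h5 : ((fun f : Sym2 V → Prop => f e) ∘ fun (G : SimpleGraph V) e => e ∈ G.edgeSet) ⁻¹' {True}
      = {G | e ∈ G.edgeSet} := by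
    ext G; simp
  rw [h5] at h4
  rw [h4]
  simp [measureReal_def, he]

/-- An event depending only on the edges in `K` is the preimage of its own image under restriction
of the edge indicators to `K`. Independence of the two blocks of indicators then applies. -/
lemma DependsOnEdges.measure_inter {I J : Set (Sym2 V)} {E F : Set (SimpleGraph V)}
    (hE : DependsOnEdges I E) (hF : DependsOnEdges J F) (hIJ : Disjoint I J) (p : unitInterval) :
    (SimpleGraph.binomialRandom V p) (E ∩ F) =
      (SimpleGraph.binomialRandom V p) E * (SimpleGraph.binomialRandom V p) F := by
  classical
  have hd : Disjoint I.toFinset J.toFinset := by simpa using hIJ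
  have hind := (iIndepFun_mem_edgeSet (V := V) p).indepFun_finset I.toFinset J.toFinset hd
    (fun e => .of_discrete)
  have key : ∀ {K : Set (Sym2 V)} {D : Set (SimpleGraph V)}, DependsOnEdges K D →
      (fun (G : SimpleGraph V) (i : K.toFinset) => (i : Sym2 V) ∈ G.edgeSet) ⁻¹'
        ((fun (G : SimpleGraph V) (i : K.toFinset) => (i : Sym2 V) ∈ G.edgeSet) '' D) = D := by
    intro K D hD
    refine Set.Subset.antisymm ?_ (Set.subset_preimage_image _ _)
    rintro G ⟨G', hG', hGG'⟩
    refine hD G' G (fun e he => ?_) hG'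
    exact iff_of_eq (congrFun hGG' ⟨e, by simpa using he⟩)
  have h := hind.measure_inter_preimage_eq_mul
    ((fun (G : SimpleGraph V) (i : I.toFinset) => (i : Sym2 V) ∈ G.edgeSet) '' E)
    ((fun (G : SimpleGraph V) (i : J.toFinset) => (i : Sym2 V) ∈ G.edgeSet) '' F)
    .of_discrete .of_discrete
  rwa [key hE, key hF] at h

lemma iIndepSet_of_dependsOnEdges {ι : Type*} {J : ι → Set (Sym2 V)} {F : ι → Set (SimpleGraph V)}
    (hF : ∀ i, DependsOnEdges (J i) (F i)) (hJ : Pairwise (Function.onFun Disjoint J))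
    (p : unitInterval) : iIndepSet F (SimpleGraph.binomialRandom V p) := by
  classical
  rw [iIndepSet_iff_meas_biInter (fun i => .of_discrete)]
  intro s
  -- The induction also carries the edge dependence of the partial intersection, which is needed to
  -- split off the next event.
  have : DependsOnEdges (⋃ i ∈ s, J i) (⋂ i ∈ s, F i) ∧
      (SimpleGraph.binomialRandom V p) (⋂ i ∈ s, F i) =
        ∏ i ∈ s, (SimpleGraph.binomialRandom V p) (F i) := by
    induction s using Finset.induction_on with
    | empty => exact ⟨fun _ _ _ _ => by simp, by simp⟩
    | insert a s ha ih =>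
      rw [Finset.set_biUnion_insert, Finset.set_biInter_insert, Finset.prod_insert ha, ← ih.2]
      refine ⟨(hF a).inter ih.1, (hF a).measure_inter ih.1 ?_ p⟩
      rw [Set.disjoint_iUnion₂_right]
      intro i hi
      exact hJ (fun h => ha (h ▸ hi))
  exact this.2

lemma binomialRandom_real_exists_adj (p : unitInterval) {v : V} {S : Finset V} (hv : v ∉ S) :
    (SimpleGraph.binomialRandom V p).real {G | ∃ u ∈ S, G.Adj v u} = 1 - (1 - p : ℝ) ^ S.card := by
  classical
  have hind := iIndepSet_of_dependsOnEdges (V := V) (J := fun u : V => {s(v, u)})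
    (F := fun u => {G | s(v, u) ∈ G.edgeSet}ᶜ)
    (fun u => DependsOnEdges.compl fun G G' h hG => (h _ rfl).1 hG)
    (fun u u' huu' => by simp [Function.onFun]; grind) p
  rw [iIndepSet_iff_meas_biInter (fun i => .of_discrete)] at hind
  have h2 : {G : SimpleGraph V | ∃ u ∈ S, G.Adj v u}ᶜ = ⋂ u ∈ S, {G | s(v, u) ∈ G.edgeSet}ᶜ := by
    ext G; simp
  have h3 : (SimpleGraph.binomialRandom V p).real {G | ∃ u ∈ S, G.Adj v u}ᶜ
      = (1 - p : ℝ) ^ S.card := by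
    rw [h2, measureReal_def, hind S, ENNReal.toReal_prod, ← Finset.prod_const]
    refine Finset.prod_congr rfl fun u hu => ?_
    rw [← measureReal_def, probReal_compl_eq_one_sub .of_discrete, binomialRandom_real_edge]
    simpa using fun h : v = u => hv (h ▸ hu)
  rw [probReal_compl_eq_one_sub .of_discrete] at h3
  linarith

end EdgeIndependence

/-! ### Chernoff bounds for sums of independent indicators -/

section Chernoff

variable {Ω ι : Type*} [MeasurableSpace Ω] {μ : Measure Ω} [IsProbabilityMeasure μ] [Fintype ι]
  {F : ι → Set Ω} {q : ℝ}

/-- Moment generating function of the number of events that occur, for independent events of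
probability `q`. -/
lemma mgf_sum_indicator_le (hind : iIndepSet F μ) (hF : ∀ i, MeasurableSet (F i))
    (hq : ∀ i, μ.real (F i) = q) (l : ℝ) :
    mgf (∑ i, (F i).indicator (fun _ => (1 : ℝ))) μ l ≤
      Real.exp (Fintype.card ι * q * (Real.exp l - 1)) := by
  have hm : ∀ i, Measurable ((F i).indicator (fun _ => (1 : ℝ))) :=
    fun i => measurable_const.indicator (hF i)
  have h1 : ∀ i, mgf ((F i).indicator (fun _ => (1 : ℝ))) μ l = 1 + q * (Real.exp l - 1) := by
    intro i
    have h2 : (fun ω => Real.exp (l * (F i).indicator (fun _ => (1 : ℝ)) ω)) =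
        fun ω => 1 + (F i).indicator (fun _ => Real.exp l - 1) ω := by
      funext ω
      by_cases h : ω ∈ F i <;> simp [h]
    rw [mgf, h2, integral_add (integrable_const _) ((integrable_const _).indicator (hF i)),
      integral_indicator_const _ (hF i), hq i]
    simp
  rw [(iIndepSet.iIndepFun_indicator hind).mgf_sum hm, mul_assoc, Real.exp_nat_mul,
    ← Finset.card_univ, ← Finset.prod_const]
  refine Finset.prod_le_prod (fun i _ => mgf_nonneg) fun i _ => ?_
  rw [h1 i]
  linarith [Real.add_one_le_exp (q * (Real.exp l - 1))]

lemma integrable_exp_sum_indicator (hF : ∀ i, MeasurableSet (F i)) (l : ℝ) :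
    Integrable (fun ω => Real.exp (l * (∑ i, (F i).indicator (fun _ => (1 : ℝ))) ω)) μ := by
  have hm : Measurable (∑ i, (F i).indicator (fun _ => (1 : ℝ))) := by
    have h : Measurable fun ω => ∑ i, (F i).indicator (fun _ => (1 : ℝ)) ω :=
      Finset.measurable_sum _ fun i _ => measurable_const.indicator (hF i)
    convert h using 1
    exact funext fun ω => Finset.sum_apply _ _ _
  refine integrable_exp_mul_of_mem_Icc (a := 0) (b := Fintype.card ι) hm.aemeasurable
    (Eventually.of_forall fun ω => ?_)
  rw [Finset.sum_apply]
  refine ⟨Finset.sum_nonneg fun i _ => Set.indicator_nonneg (fun _ _ => zero_le_one) _, ?_⟩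
  refine (Finset.sum_le_card_nsmul _ _ 1 fun i _ => ?_).trans (by simp)
  exact Set.indicator_le_self' (fun _ _ => zero_le_one) _

lemma measureReal_le_sum_indicator (hind : iIndepSet F μ) (hF : ∀ i, MeasurableSet (F i))
    (hq : ∀ i, μ.real (F i) = q) {l : ℝ} (hl : 0 ≤ l) (y : ℝ) :
    μ.real {ω | y ≤ (∑ i, (F i).indicator (fun _ => (1 : ℝ))) ω} ≤
      Real.exp (Fintype.card ι * q * (Real.exp l - 1) - l * y) := by
  refine (measure_ge_le_exp_mul_mgf y hl (integrable_exp_sum_indicator hF l)).trans ?_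
  rw [sub_eq_neg_add, ← neg_mul, Real.exp_add]
  gcongr
  exact mgf_sum_indicator_le hind hF hq l

lemma measureReal_sum_indicator_le (hind : iIndepSet F μ) (hF : ∀ i, MeasurableSet (F i))
    (hq : ∀ i, μ.real (F i) = q) {l : ℝ} (hl : 0 ≤ l) (y : ℝ) :
    μ.real {ω | (∑ i, (F i).indicator (fun _ => (1 : ℝ))) ω ≤ y} ≤
      Real.exp (Fintype.card ι * q * (Real.exp (-l) - 1) + l * y) := by
  refine (measure_le_le_exp_mul_mgf y (neg_nonpos.2 hl)
    (integrable_exp_sum_indicator hF (-l))).trans ?_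
  rw [neg_neg, add_comm, Real.exp_add]
  gcongr
  exact mgf_sum_indicator_le hind hF hq (-l)

/-- Two-sided concentration of the number of independent events that occur, with failure
probability `2 e ^ (-3 L)`. -/
lemma measureReal_deviation_le (hind : iIndepSet F μ) (hF : ∀ i, MeasurableSet (F i))
    (hq : ∀ i, μ.real (F i) = q) (hq0 : 0 ≤ q) {L : ℝ} (hL : 0 < L) :
    μ.real {ω | 4 * (√(Fintype.card ι * q * L) + L) ≤
        |(∑ i, (F i).indicator (fun _ => (1 : ℝ))) ω - Fintype.card ι * q|} ≤
      2 * Real.exp (-3 * L) := by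
  set M : ℝ := Fintype.card ι * q with hM
  have hM0 : 0 ≤ M := by positivity
  set x : ℝ := 4 * (√(M * L) + L) with hx
  -- The Chernoff exponent is at most `M l² - l x` for `l ≤ 1`. Taking `l = √(L / M)` gives `M l² =
  -- L` and `l x ≥ 4 L`; when `M ≤ L` this is capped at `l = 1`.
  obtain ⟨l, hl0, hl1, hl⟩ : ∃ l : ℝ, 0 ≤ l ∧ l ≤ 1 ∧ M * l ^ 2 - l * x ≤ -3 * L := by
    rcases le_total M L with h | h
    · refine ⟨1, zero_le_one, le_rfl, ?_⟩
      have := Real.sqrt_nonneg (M * L)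
      simp only [hx]; linarith
    · have hMp : 0 < M := hL.trans_le h
      refine ⟨√(L / M), Real.sqrt_nonneg _, Real.sqrt_le_one.2 ((div_le_one hMp).2 h), ?_⟩
      have e1 : √(L / M) ^ 2 = L / M := Real.sq_sqrt (by positivity)
      have e2 : √(L / M) * √(M * L) = L := by
        rw [← Real.sqrt_mul (by positivity), show L / M * (M * L) = L ^ 2 by field_simp,
          Real.sqrt_sq hL.le]
      have e3 : 0 ≤ √(L / M) * L := by positivity
      have e4 : M * (L / M) = L := by field_simp
      rw [e1, hx, e4]
      nlinarith
  have habs : ∀ y : ℝ, |y| = l → Real.exp y - 1 - y ≤ l ^ 2 := by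
    intro y hy
    have h := Real.abs_exp_sub_one_sub_id_le (x := y) (by rw [hy]; exact hl1)
    rw [← sq_abs y, hy] at h
    exact (le_abs_self _).trans h
  have hsub : {ω | x ≤ |(∑ i, (F i).indicator (fun _ => (1 : ℝ))) ω - M|} ⊆
      {ω | M + x ≤ (∑ i, (F i).indicator (fun _ => (1 : ℝ))) ω} ∪
        {ω | (∑ i, (F i).indicator (fun _ => (1 : ℝ))) ω ≤ M - x} := by
    intro ω hω
    rcases le_abs.1 (Set.mem_ofPred_eq ▸ hω) with h | h
    · left; simp only [Set.mem_ofPred_eq]; linarith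
    · right; simp only [Set.mem_ofPred_eq]; linarith
  refine (measureReal_mono hsub).trans ((measureReal_union_le _ _).trans ?_)
  rw [two_mul]
  refine add_le_add ((measureReal_le_sum_indicator hind hF hq hl0 _).trans ?_)
    ((measureReal_sum_indicator_le hind hF hq hl0 _).trans ?_)
  · rw [Real.exp_le_exp, ← hM]
    have := mul_le_mul_of_nonneg_left (habs l (abs_of_nonneg hl0)) hM0
    linarith
  · rw [Real.exp_le_exp, ← hM]
    have := mul_le_mul_of_nonneg_left (habs (-l) (by rw [abs_neg, abs_of_nonneg hl0])) hM0
    linarith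

end Chernoff

/-! ### Breadth-first exploration and the law of the next shell -/

section Exploration

variable {V : Type*} {G : SimpleGraph V} {w : V}

/-- The vertices outside `A ∪ S` that have a neighbour in `S`. -/
def frontier (G : SimpleGraph V) (A S : Set V) : Set V :=
  {v | v ∉ A ∪ S ∧ ∃ u ∈ S, G.Adj v u}

lemma edist_le_succ_iff {v : V} {r : ℕ} :
    G.edist v w ≤ (r + 1 : ℕ) ↔ G.edist v w ≤ r ∨ ∃ u, G.Adj v u ∧ G.edist u w ≤ r := by
  constructor
  · intro h
    obtain ⟨p, hp⟩ := SimpleGraph.exists_walk_of_edist_ne_top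
      (ne_top_of_le_ne_top (ENat.natCast_ne_top _) h)
    rw [← hp, Nat.cast_le] at h
    cases p with
    | nil => left; simp
    | cons hadj p =>
      right
      refine ⟨_, hadj, (SimpleGraph.edist_le p).trans ?_⟩
      rw [SimpleGraph.Walk.length_cons] at h
      exact_mod_cast Nat.le_of_succ_le_succ h
  · rintro (h | ⟨u, hadj, h⟩)
    · exact h.trans (by exact_mod_cast Nat.le_succ r)
    · refine SimpleGraph.edist_triangle.trans ((add_le_add
        (SimpleGraph.edist_eq_one_iff_adj.2 hadj).le h).trans ?_)
      rw [add_comm]; push_cast; rfl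

lemma mem_ball_union_shell {v : V} {s : ℕ} :
    v ∈ G.ball w s ∪ shell G w s ↔ G.edist v w ≤ s := by
  rw [Set.mem_union, SimpleGraph.mem_ball, le_iff_lt_or_eq]; rfl

/-- Balls are open, so the ball of radius `s + 1` is everything at distance at most `s`. -/
lemma ball_succ (G : SimpleGraph V) (w : V) (s : ℕ) :
    G.ball w (s + 1 : ℕ) = G.ball w s ∪ shell G w s := by
  ext v
  rw [mem_ball_union_shell, SimpleGraph.mem_ball, Nat.cast_add, Nat.cast_one,
    ENat.lt_add_one_iff (ENat.natCast_ne_top s)]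

lemma disjoint_ball_shell (G : SimpleGraph V) (w : V) (s : ℕ) :
    Disjoint (G.ball w s) (shell G w s) :=
  Set.disjoint_left.2 fun _ h h' => (ne_of_lt h) h'

lemma shell_zero (G : SimpleGraph V) (w : V) : shell G w 0 = {w} := by
  ext v; simp [shell]

/-- A neighbour of `v` strictly inside the ball would put `v` at distance at most `s`; hence the
neighbour that reaches `v` lies in the shell itself. -/
lemma shell_succ (G : SimpleGraph V) (w : V) (s : ℕ) :
    shell G w (s + 1) = frontier G (G.ball w s) (shell G w s) := by
  ext v
  have h1 : v ∈ shell G w (s + 1) ↔ G.edist v w ≤ (s + 1 : ℕ) ∧ ¬ G.edist v w ≤ s := by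
    change G.edist v w = (s + 1 : ℕ) ↔ _
    rw [not_le, ← not_lt (a := ((s + 1 : ℕ) : ℕ∞)), eq_iff_le_not_lt, not_lt, Nat.cast_add,
      Nat.cast_one, ENat.add_one_le_iff (ENat.natCast_ne_top s)]
    simp
  rw [h1, edist_le_succ_iff, frontier, Set.mem_ofPred_eq, mem_ball_union_shell]
  constructor
  · rintro ⟨h | ⟨u, hadj, hu⟩, h2⟩
    · exact absurd h h2
    · refine ⟨h2, u, ?_, hadj⟩
      rcases mem_ball_union_shell.2 hu with h | h
      · refine absurd ?_ h2
        have h3 : G.edist v w ≤ 1 + G.edist u w :=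
          SimpleGraph.edist_triangle.trans
            (add_le_add (SimpleGraph.edist_eq_one_iff_adj.2 hadj).le le_rfl)
        refine h3.trans ?_
        rw [add_comm]
        exact Order.add_one_le_of_lt h
      · exact h
  · rintro ⟨h2, u, hu, hadj⟩
    exact ⟨.inr ⟨u, hadj, le_of_eq hu⟩, h2⟩

/-- Exploring the ball of radius `s` reveals only the edges that meet it. -/
lemma dependsOnEdges_ball_shell (w : V) (s : ℕ) (A S : Set V) :
    DependsOnEdges {e | ∃ a ∈ A, a ∈ e} {G | G.ball w s = A ∧ shell G w s = S} := by
  rintro G G' hGG' ⟨rfl, rfl⟩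
  -- A vertex within distance `r + 1 ≤ s` but not within `r` is reached from a vertex at distance at
  -- most `r < s`. That vertex lies in `A`, so the edge used is one on which the graphs agree.
  have key : ∀ r : ℕ, r ≤ s → ∀ v, G'.edist v w ≤ r ↔ G.edist v w ≤ r := by
    intro r
    induction r with
    | zero => intro _ v; simp
    | succ r ih =>
      intro hr v
      rw [edist_le_succ_iff, edist_le_succ_iff, ih (by omega)]
      refine or_congr_right (exists_congr fun u => ?_)
      rw [ih (by omega)]
      refine and_congr_left fun hu => ?_
      have := hGG' s(v, u) ⟨u, lt_of_le_of_lt hu (by exact_mod_cast hr), by simp⟩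
      simpa using this.symm
  have hball : G'.ball w s = G.ball w s := by
    rcases s with _ | s
    · simp
    · ext v
      rw [ball_succ, ball_succ, mem_ball_union_shell, mem_ball_union_shell, key s (by omega)]
  refine ⟨hball, ?_⟩
  ext v
  have h1 := key s le_rfl v
  have h2 : v ∈ G'.ball w s ↔ v ∈ G.ball w s := by rw [hball]
  rw [SimpleGraph.mem_ball, SimpleGraph.mem_ball] at h2
  change G'.edist v w = s ↔ G.edist v w = s
  rw [eq_iff_le_not_lt, eq_iff_le_not_lt, h1, h2]

/-- When `A` and `S` are disjoint, none of these edges meets `A`, so the frontier is independent of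
the exploration that revealed `(A, S)`. -/
lemma dependsOnEdges_frontier (A S : Set V) (P : Set V → Prop) :
    DependsOnEdges {e | ∃ v ∉ A ∪ S, ∃ u ∈ S, e = s(v, u)} {G | P (frontier G A S)} := by
  intro G G' hGG' hG
  have : frontier G' A S = frontier G A S := by
    ext v
    refine and_congr_right fun hv => exists_congr fun u => and_congr_right fun hu => ?_
    simpa using (hGG' s(v, u) ⟨v, hv, u, hu, rfl⟩).symm
  simpa [this] using hG

/-- The event that `v` has a neighbour in `S`, for each `v` outside `A ∪ S`. -/
def attached (A S : Set V) (v : ↥(A ∪ S)ᶜ) : Set (SimpleGraph V) :=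
  {G | ∃ u ∈ S, G.Adj v u}

lemma ncard_frontier (G : SimpleGraph V) (A S : Set V) [Fintype ↥(A ∪ S)ᶜ] :
    ((frontier G A S).ncard : ℝ) =
      (∑ v, (attached A S v).indicator (fun _ => (1 : ℝ))) G := by
  classical
  have h1 : frontier G A S = Subtype.val '' {v : ↥(A ∪ S)ᶜ | G ∈ attached A S v} := by
    ext v
    simp [frontier, attached]
    tauto
  rw [Finset.sum_apply]
  simp only [Set.indicator_apply]
  rw [Finset.sum_boole, h1, Set.ncard_image_of_injective _ Subtype.val_injective,
    Set.ncard_eq_toFinset_card']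
  congr 2
  ext v; simp

variable [Fintype V]

/-- The next shell is distributed like the frontier of the explored state. -/
lemma measureReal_shell_succ_le (p : unitInterval) (w : V) (s : ℕ)
    (R : Set V → Set V → ℕ → Prop) {δ : ℝ}
    (h : ∀ A S : Set V, Disjoint A S → (A = ∅ ∨ 1 ≤ s) → (s = 0 → S = {w}) →
      (SimpleGraph.binomialRandom V p).real {G | R A S (frontier G A S).ncard} ≤ δ) :
    (SimpleGraph.binomialRandom V p).real
      {G | R (G.ball w s) (shell G w s) (shell G w (s + 1)).ncard} ≤ δ := by
  classical
  set μ := SimpleGraph.binomialRandom V p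
  let f : SimpleGraph V → Set V × Set V := fun G => (G.ball w s, shell G w s)
  have hsub : {G | R (G.ball w s) (shell G w s) (shell G w (s + 1)).ncard} ⊆
      ⋃ y : Set V × Set V, f ⁻¹' {y} ∩ {G | R y.1 y.2 (frontier G y.1 y.2).ncard} := by
    intro G hG
    refine Set.mem_iUnion.2 ⟨f G, rfl, ?_⟩
    rw [Set.mem_ofPred_eq, shell_succ] at hG
    exact hG
  -- On each fibre of the explored state the probability factorises. A graph in the fibre supplies
  -- the side conditions on `(A, S)`, which is why empty fibres are treated apart.
  have hterm : ∀ y : Set V × Set V,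
      μ.real (f ⁻¹' {y} ∩ {G | R y.1 y.2 (frontier G y.1 y.2).ncard}) ≤ μ.real (f ⁻¹' {y}) * δ := by
    rintro ⟨A, S⟩
    rcases Set.eq_empty_or_nonempty (f ⁻¹' {(A, S)}) with he | ⟨G, hG⟩
    · simp [he]
    have hG' : G.ball w s = A ∧ shell G w s = S := Prod.ext_iff.1 hG
    have hd : Disjoint A S := by
      rw [← hG'.1, ← hG'.2]; exact disjoint_ball_shell G w s
    have h1 : f ⁻¹' {(A, S)} = {G | G.ball w s = A ∧ shell G w s = S} := by
      ext G; simp [f]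
    have h2 := (dependsOnEdges_ball_shell w s A S).measure_inter
      (dependsOnEdges_frontier A S (fun T => R A S T.ncard)) ?_ p
    · rw [h1, measureReal_def, h2, ENNReal.toReal_mul]
      refine mul_le_mul_of_nonneg_left (h A S hd ?_ ?_) ENNReal.toReal_nonneg
      · rcases Nat.eq_zero_or_pos s with rfl | hs
        · left; rw [← hG'.1]; simp
        · exact .inr hs
      · rintro rfl
        rw [← hG'.2, shell_zero]
    · rw [Set.disjoint_left]
      rintro e ⟨a, ha, hae⟩ ⟨v, hv, u, hu, rfl⟩
      rcases Sym2.mem_iff.1 hae with rfl | rfl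
      · exact hv (.inl ha)
      · exact Set.disjoint_left.1 hd ha hu
  refine (measureReal_mono hsub).trans ((measureReal_iUnion_fintype_le _).trans
    ((Finset.sum_le_sum fun y _ => hterm y).trans ?_))
  rw [← Finset.sum_mul, sum_measureReal_preimage_singleton _ (fun y _ => .of_discrete)]
  simp

/-- Distinct vertices outside `S` are joined to `S` by disjoint sets of edges. -/
lemma iIndepSet_attached (p : unitInterval) (A S : Set V) :
    iIndepSet (attached A S) (SimpleGraph.binomialRandom V p) := by
  refine iIndepSet_of_dependsOnEdges (J := fun v => {e | ∃ u ∈ S, e = s(v.1, u)}) ?_ ?_ p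
  · rintro v G G' hGG' ⟨u, hu, hadj⟩
    exact ⟨u, hu, (hGG' s(v.1, u) ⟨u, hu, rfl⟩).1 hadj⟩
  · intro v v' hvv'
    rw [Function.onFun, Set.disjoint_left]
    rintro e ⟨u, hu, rfl⟩ ⟨u', hu', he⟩
    rcases Sym2.eq_iff.1 he with ⟨h, -⟩ | ⟨h, -⟩
    · exact hvv' (Subtype.ext h)
    · exact v.2 (.inr (h ▸ hu'))

lemma binomialRandom_real_attached (p : unitInterval) (A S : Set V) (v : ↥(A ∪ S)ᶜ) :
    (SimpleGraph.binomialRandom V p).real (attached A S v) = 1 - (1 - p : ℝ) ^ S.ncard := by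
  classical
  have := binomialRandom_real_exists_adj (V := V) p (v := v) (S := S.toFinset)
    (by simpa using fun h => v.2 (.inr h))
  rw [Set.ncard_eq_toFinset_card', ← this]
  simp [attached]

/-- The expected size of the shell following a shell of size `m`, when `a` vertices have been
explored before. -/
noncomputable def meanNext (n : ℕ) (p : ℝ) (a m : ℕ) : ℝ :=
  (n - a - m : ℝ) * (1 - (1 - p) ^ m)

lemma card_compl_union {A S : Set V} (hd : Disjoint A S) [Fintype ↥(A ∪ S)ᶜ] :
    (Fintype.card ↥(A ∪ S)ᶜ : ℝ) = Fintype.card V - A.ncard - S.ncard := by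
  have h1 := Set.ncard_add_ncard_compl (A ∪ S)
  rw [Set.ncard_union_eq hd, Nat.card_eq_fintype_card] at h1
  rw [← Nat.card_eq_fintype_card, Nat.card_coe_set_eq, ← h1]
  push_cast; ring

lemma measureReal_frontier_deviation_le (p : unitInterval) {A S : Set V} (hd : Disjoint A S)
    {L : ℝ} (hL : 0 < L) :
    (SimpleGraph.binomialRandom V p).real {G | 4 * (√(meanNext (Fintype.card V) p A.ncard S.ncard * L)
      + L) ≤ |((frontier G A S).ncard : ℝ) - meanNext (Fintype.card V) p A.ncard S.ncard|} ≤
      2 * Real.exp (-3 * L) := by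
  classical
  have hq : 0 ≤ 1 - (1 - p : ℝ) ^ S.ncard :=
    sub_nonneg.2 (pow_le_one₀ (sub_nonneg.2 p.2.2) (by linarith [p.2.1]))
  have h := measureReal_deviation_le (iIndepSet_attached p A S) (fun _ => .of_discrete)
    (binomialRandom_real_attached p A S) hq hL
  simp_rw [← ncard_frontier] at h
  rw [card_compl_union hd] at h
  exact h

/-- The size of a next shell in every exploration is close to its conditional expectation. -/
lemma measureReal_shell_deviation_le (p : unitInterval) (w : V) (s : ℕ) {L : ℝ} (hL : 0 < L) :
    (SimpleGraph.binomialRandom V p).real {G |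
      4 * (√(meanNext (Fintype.card V) p (G.ball w s).ncard (shell G w s).ncard * L) + L) ≤
        |((shell G w (s + 1)).ncard : ℝ)
          - meanNext (Fintype.card V) p (G.ball w s).ncard (shell G w s).ncard|} ≤
      2 * Real.exp (-3 * L) :=
  measureReal_shell_succ_le p w s (fun A S k =>
    4 * (√(meanNext (Fintype.card V) p A.ncard S.ncard * L) + L) ≤
      |(k : ℝ) - meanNext (Fintype.card V) p A.ncard S.ncard|)
    fun _ _ hd _ _ => measureReal_frontier_deviation_le p hd hL

/-- The parameter `l` stays free because for `d` close to `c log n` the two-sided bound gives no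
useful lower bound on degrees; a large `l` is needed there. -/
lemma measureReal_shell_one_le (p : unitInterval) (w : V) (y : ℝ) {l : ℝ} (hl : 0 ≤ l) :
    (SimpleGraph.binomialRandom V p).real {G | ((shell G w 1).ncard : ℝ) ≤ y} ≤
      Real.exp ((Fintype.card V - 1) * p * (Real.exp (-l) - 1) + l * y) := by
  classical
  refine measureReal_shell_succ_le p w 0 (fun _ _ k => (k : ℝ) ≤ y) fun A S hd hA hS => ?_
  obtain rfl : A = ∅ := hA.resolve_right (by omega)
  obtain rfl : S = {w} := hS rfl
  have h := measureReal_sum_indicator_le (iIndepSet_attached p ∅ {w}) (fun _ => .of_discrete)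
    (binomialRandom_real_attached p ∅ {w}) hl y
  simp_rw [← ncard_frontier] at h
  rw [card_compl_union hd] at h
  simpa using h

end Exploration

/-! ### Events with high probability and simultaneous concentration -/

section WHP

variable {d : ℕ → ℝ} {E F : (n : ℕ) → SimpleGraph (Fin n) → Prop}

lemma WHP.mono (hE : WHP d E) (h : ∀ᶠ n in atTop, ∀ G, E n G → F n G) : WHP d F := by
  refine tendsto_of_tendsto_of_tendsto_of_le_of_le' hE tendsto_const_nhds ?_
    (Eventually.of_forall fun n => measureReal_le_one)
  filter_upwards [h] with n hn
  exact measureReal_mono fun G hG => hn G hG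

lemma WHP.of_compl_le {f : ℕ → ℝ} (hf : Tendsto f atTop (𝓝 0))
    (h : ∀ᶠ n : ℕ in atTop, (SimpleGraph.binomialRandom (Fin n) (edgeProb (d n / n))).real
      {G | ¬ E n G} ≤ f n) : WHP d E := by
  have h1 : Tendsto (fun n => 1 - f n) atTop (𝓝 1) := by simpa using hf.const_sub 1
  refine tendsto_of_tendsto_of_tendsto_of_le_of_le' h1 tendsto_const_nhds ?_
    (Eventually.of_forall fun n => measureReal_le_one)
  filter_upwards [h] with n hn
  have h2 : {G | ¬ E n G} = {G | E n G}ᶜ := rfl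
  rw [h2, probReal_compl_eq_one_sub .of_discrete] at hn
  linarith

lemma WHP.and (hE : WHP d E) (hF : WHP d F) : WHP d fun n G => E n G ∧ F n G := by
  have h1 := (hE.const_sub 1).add (hF.const_sub 1)
  rw [sub_self, add_zero] at h1
  refine WHP.of_compl_le h1 (Eventually.of_forall fun n => ?_)
  have h2 : {G | ¬ (E n G ∧ F n G)} = {G | E n G}ᶜ ∪ {G | F n G}ᶜ := by
    ext G; simp [imp_iff_not_or]
  rw [h2]
  refine (measureReal_union_le _ _).trans ?_
  rw [probReal_compl_eq_one_sub .of_discrete, probReal_compl_eq_one_sub .of_discrete]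

/-- The sizes of all shells `V_{s+1}(w)` with `s ≤ n` are close to their conditional expectations
given the first `s` shells. -/
def Concentrated (n : ℕ) (p : ℝ) (G : SimpleGraph (Fin n)) : Prop :=
  ∀ w : Fin n, ∀ s ≤ n,
    |((shell G w (s + 1)).ncard : ℝ) - meanNext n p (G.ball w s).ncard (shell G w s).ncard| ≤
      4 * (√(meanNext n p (G.ball w s).ncard (shell G w s).ncard * Real.log n) + Real.log n)

/-- With `L = log n` each pair `(w, s)` fails with probability at most `2 / n ^ 3`, and there are `n
(n + 1)` pairs. -/
lemma whp_concentrated (d : ℕ → ℝ) :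
    WHP d fun n G => Concentrated n (edgeProb (d n / n)) G := by
  have hlim : Tendsto (fun n : ℕ => 4 * (1 / (n : ℝ))) atTop (𝓝 0) := by
    simpa using tendsto_one_div_atTop_nhds_zero_nat.const_mul (4 : ℝ)
  refine WHP.of_compl_le hlim ?_
  filter_upwards [eventually_ge_atTop 2] with n hn
  have hn0 : (0 : ℝ) < n := by positivity
  have hL : 0 < Real.log n := Real.log_pos (by exact_mod_cast hn)
  set μ := SimpleGraph.binomialRandom (Fin n) (edgeProb (d n / n))
  have hsub : {G | ¬ Concentrated n (edgeProb (d n / n)) G} ⊆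
      ⋃ y : Fin n × Fin (n + 1), {G : SimpleGraph (Fin n) |
      4 * (√(meanNext (Fintype.card (Fin n)) (edgeProb (d n / n)) (G.ball y.1 (y.2 : ℕ)).ncard
        (shell G y.1 y.2).ncard * Real.log n) + Real.log n) ≤
        |((shell G y.1 (y.2 + 1)).ncard : ℝ) - meanNext (Fintype.card (Fin n))
          (edgeProb (d n / n)) (G.ball y.1 (y.2 : ℕ)).ncard (shell G y.1 y.2).ncard|} := by
    intro G hG
    simp only [Concentrated, Set.mem_ofPred_eq, not_forall, not_le] at hG
    obtain ⟨w, s, hs, h⟩ := hG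
    refine Set.mem_iUnion.2 ⟨(w, ⟨s, by omega⟩), ?_⟩
    simp only [Fintype.card_fin]
    exact h.le
  refine (measureReal_mono hsub).trans ((measureReal_iUnion_fintype_le _).trans
    ((Finset.sum_le_card_nsmul _ _ _ fun y _ =>
      measureReal_shell_deviation_le _ y.1 y.2 hL).trans ?_))
  have he : Real.exp (-3 * Real.log n) = 1 / (n : ℝ) ^ 3 := by
    rw [show -3 * Real.log n = -(3 * Real.log n) by ring, Real.exp_neg,
      show (3 : ℝ) * Real.log n = ((3 : ℕ) : ℝ) * Real.log n by norm_num, Real.exp_nat_mul,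
      Real.exp_log hn0, one_div]
  rw [he, Finset.card_univ, Fintype.card_prod, Fintype.card_fin, Fintype.card_fin, nsmul_eq_mul]
  push_cast
  have h1 : (1 : ℝ) ≤ n := by exact_mod_cast (by omega : 1 ≤ n)
  rw [show (n : ℝ) * (n + 1) * (2 * (1 / n ^ 3)) = (2 * (n + 1)) / (n ^ 2) by field_simp,
    div_le_iff₀ (by positivity)]
  rw [show 4 * (1 / (n : ℝ)) * n ^ 2 = 4 * n by field_simp]
  linarith

end WHP

/-! ### Deterministic growth of shells under concentration -/

section Growth

variable {n : ℕ} {p d : ℝ} {G : SimpleGraph (Fin n)} {w : Fin n}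

lemma one_sub_pow_le_exp {p : ℝ} (hp1 : p ≤ 1) (m : ℕ) :
    (1 - p) ^ m ≤ Real.exp (-(p * m)) := by
  rw [show -(p * m) = m * -p by ring, Real.exp_nat_mul]
  exact pow_le_pow_left₀ (sub_nonneg.2 hp1) (by linarith [Real.add_one_le_exp (-p)]) m

/-- `(1 - x + x²)(1 + x) = 1 + x³ ≥ 1` and `1 + x ≤ exp x`. -/
lemma exp_neg_le_one_sub_add_sq {x : ℝ} (hx : 0 ≤ x) : Real.exp (-x) ≤ 1 - x + x ^ 2 := by
  rw [Real.exp_neg]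
  refine inv_le_of_inv_le₀ (by nlinarith [sq_nonneg (x - 1)]) ?_
  refine le_trans ?_ (Real.add_one_le_exp x)
  rw [inv_le_iff_one_le_mul₀ (by nlinarith [sq_nonneg (x - 1)])]
  nlinarith [pow_nonneg hx 3]

lemma meanNext_le (hp0 : 0 ≤ p) (hp1 : p ≤ 1) (a m : ℕ) : meanNext n p a m ≤ n * (p * m) := by
  have h1 : 1 - (1 - p) ^ m ≤ p * m := by
    have := one_add_mul_le_pow (a := -p) (by linarith) m
    rw [← sub_eq_add_neg] at this
    linarith
  have h2 : 0 ≤ 1 - (1 - p) ^ m := sub_nonneg.2 (pow_le_one₀ (by linarith) (by linarith))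
  have h3 : (n - a - m : ℝ) ≤ n := by
    have : (0 : ℝ) ≤ a := a.cast_nonneg
    have : (0 : ℝ) ≤ m := m.cast_nonneg
    linarith
  exact (mul_le_mul_of_nonneg_right h3 h2).trans (mul_le_mul_of_nonneg_left h1 n.cast_nonneg)

lemma meanNext_le_card (hp0 : 0 ≤ p) (hp1 : p ≤ 1) (a m : ℕ) : meanNext n p a m ≤ n := by
  have h1 : 1 - (1 - p) ^ m ≤ 1 := by linarith [pow_nonneg (sub_nonneg.2 hp1) m]
  have h2 : 0 ≤ 1 - (1 - p) ^ m := sub_nonneg.2 (pow_le_one₀ (by linarith) (by linarith))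
  have h3 : (n - a - m : ℝ) ≤ n := by
    have : (0 : ℝ) ≤ a := a.cast_nonneg
    have : (0 : ℝ) ≤ m := m.cast_nonneg
    linarith
  calc meanNext n p a m ≤ n * (1 - (1 - p) ^ m) := mul_le_mul_of_nonneg_right h3 h2
    _ ≤ n := mul_le_of_le_one_right n.cast_nonneg h1

/-- Two relative losses against `n p m`: the fraction already explored, and `p m` for vertices with
several neighbours in the shell. -/
lemma le_meanNext (hn : 0 < n) (hp0 : 0 ≤ p) (hp1 : p ≤ 1) {a m : ℕ} (ham : a + m ≤ n) :
    n * (p * m) * (1 - (a + m : ℕ) / n - p * m) ≤ meanNext n p a m := by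
  have hn' : (0 : ℝ) < n := by exact_mod_cast hn
  have hx : 0 ≤ p * m := by positivity
  have h1 : p * m - (p * m) ^ 2 ≤ 1 - (1 - p) ^ m := by
    linarith [one_sub_pow_le_exp hp1 m, exp_neg_le_one_sub_add_sq hx]
  have h3 : (0 : ℝ) ≤ n - a - m := by
    have : ((a + m : ℕ) : ℝ) ≤ n := by exact_mod_cast ham
    push_cast at this; linarith
  refine le_trans ?_ (mul_le_mul_of_nonneg_left h1 h3)
  have h4 : (n - a - m : ℝ) = n * (1 - (a + m : ℕ) / n) := by
    push_cast; field_simp; ring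
  rw [h4, mul_assoc (n : ℝ), mul_assoc (n : ℝ)]
  refine mul_le_mul_of_nonneg_left ?_ hn'.le
  have h5 : (0 : ℝ) ≤ (a + m : ℕ) / n := by positivity
  nlinarith [mul_nonneg h5 (mul_nonneg hx hx)]

lemma ncard_ball_succ (G : SimpleGraph (Fin n)) (w : Fin n) (s : ℕ) :
    (G.ball w (s + 1 : ℕ)).ncard = (G.ball w s).ncard + (shell G w s).ncard := by
  rw [ball_succ, Set.ncard_union_eq (disjoint_ball_shell G w s)]

lemma ncard_le_card (S : Set (Fin n)) : S.ncard ≤ n := by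
  simpa using Set.ncard_le_card S

/-- Sizes of balls from sizes of shells. -/
lemma ncard_ball_succ_le {B : ℝ} (hB : 1 ≤ B) (hd : 1 < d) (s : ℕ)
    (h : ∀ r, 1 ≤ r → r ≤ s → ((shell G w r).ncard : ℝ) ≤ B * d ^ r) :
    ((G.ball w (s + 1 : ℕ)).ncard : ℝ) ≤ B * d ^ (s + 1) / (d - 1) := by
  have hd' : 0 < d - 1 := by linarith
  induction s with
  | zero =>
    rw [ncard_ball_succ, shell_zero, le_div_iff₀ hd']
    simp
    nlinarith
  | succ s ih =>
    rw [ncard_ball_succ]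
    push_cast
    have h1 := ih fun r hr hrs => h r hr (by omega)
    have h2 := h (s + 1) (by omega) le_rfl
    push_cast at h1
    calc _ ≤ B * d ^ (s + 1) / (d - 1) + B * d ^ (s + 1) := add_le_add h1 h2
      _ = B * d ^ (s + 1 + 1) / (d - 1) := by field_simp; ring

/-- One exploration step. -/
lemma Concentrated.next_shell (hG : Concentrated n p G) (hn : 0 < n) (hp0 : 0 ≤ p) (hp1 : p ≤ 1)
    (hd : n * p = d) (hL : Real.log n ≤ d) {s : ℕ} (hs : s ≤ n)
    (hm : 1 ≤ (shell G w s).ncard) :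
    ((shell G w (s + 1)).ncard : ℝ) ≤
      d * (shell G w s).ncard * (1 + 8 / √((shell G w s).ncard : ℝ)) ∧
    d * (shell G w s).ncard * (1 - (G.ball w (s + 1 : ℕ)).ncard / n - p * (shell G w s).ncard
      - 8 / √((shell G w s).ncard : ℝ)) ≤ ((shell G w (s + 1)).ncard : ℝ) := by
  have hdev := abs_le.1 (hG w s hs)
  have ham : (G.ball w s).ncard + (shell G w s).ncard ≤ n := by
    rw [← ncard_ball_succ]; exact ncard_le_card _
  rw [ncard_ball_succ]
  set a := (G.ball w s).ncard
  set m := (shell G w s).ncard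
  have hup : meanNext n p a m ≤ d * m := by
    rw [← hd, mul_assoc]; exact meanNext_le hp0 hp1 a m
  have hlo : d * m * (1 - (a + m : ℕ) / n - p * m) ≤ meanNext n p a m := by
    rw [← hd, mul_assoc (n : ℝ)]; exact le_meanNext hn hp0 hp1 ham
  have hd0 : 0 ≤ d := by rw [← hd]; positivity
  have hm1 : (1 : ℝ) ≤ m := by exact_mod_cast hm
  have hsm : 1 ≤ √(m : ℝ) := Real.one_le_sqrt.2 hm1
  have hL0 : 0 ≤ Real.log n := Real.log_natCast_nonneg n
  -- Since `log n ≤ d`, both fluctuation terms are at most `d √m`. With the factor 4 each, this is a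
  -- relative error `8 / √m`.
  have h1 : √(meanNext n p a m * Real.log n) ≤ d * √(m : ℝ) := by
    rw [Real.sqrt_le_left (by positivity), mul_pow, Real.sq_sqrt (by positivity)]
    calc meanNext n p a m * Real.log n ≤ d * m * d := mul_le_mul hup hL hL0 (by positivity)
      _ = d ^ 2 * m := by ring
  have h2 : d * m * (8 / √(m : ℝ)) = 8 * (d * √(m : ℝ)) := by
    have : (m : ℝ) = √(m : ℝ) * √(m : ℝ) := (Real.mul_self_sqrt (by positivity)).symm
    field_simp
    rw [sq, ← this]
  have h3 : Real.log n ≤ d * √(m : ℝ) := hL.trans (le_mul_of_one_le_right hd0 hsm)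
  constructor
  · rw [mul_add, h2]; linarith
  · rw [mul_sub, h2]; linarith

/-- The accumulated relative error after `s` exploration steps. -/
noncomputable def growthError (K e₀ : ℝ) (n : ℕ) (d : ℝ) (s : ℕ) : ℝ :=
  e₀ + 2 * K * (2 * d ^ s / n + 2 * (√d)⁻¹ - 2 * (√d)⁻¹ ^ s)

/-- The closed form majorises the geometric sums: `2 (d ^ (s + 1) - d ^ s) ≥ d ^ (s + 1)`, and `2 (u
^ s - u ^ (s + 1)) ≥ u ^ s` for `u = (√d)⁻¹ ≤ 1 / 2`. The factor 2 on the step error leaves room for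
the product with the error accumulated before. -/
lemma growthError_add_le {K e₀ : ℝ} (hK : 0 ≤ K) (hd : 4 ≤ d) (s : ℕ) :
    growthError K e₀ n d s + 2 * (K * (d ^ (s + 1) / n + (√d)⁻¹ ^ s)) ≤
      growthError K e₀ n d (s + 1) := by
  have h2 : (2 : ℝ) ≤ √d := Real.le_sqrt_of_sq_le (by norm_num; linarith)
  have hu : (√d)⁻¹ ≤ 1 / 2 := by rw [one_div]; gcongr
  have hu0 : 0 ≤ (√d)⁻¹ := by positivity
  have h3 : 0 ≤ (√d)⁻¹ ^ s := by positivity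
  have h4 : 0 ≤ d ^ s / n := by positivity
  unfold growthError
  have h5 : d ^ (s + 1) / n + (√d)⁻¹ ^ s ≤ (2 * d ^ (s + 1) / n + 2 * (√d)⁻¹ - 2 * (√d)⁻¹ ^ (s + 1))
      - (2 * d ^ s / n + 2 * (√d)⁻¹ - 2 * (√d)⁻¹ ^ s) := by
    have e1 : d ^ (s + 1) / n = d ^ s / n * d := by ring
    have e2 : 2 * d ^ (s + 1) / n = 2 * (d ^ s / n * d) := by ring
    have e3 : 2 * d ^ s / n = 2 * (d ^ s / n) := by ring
    rw [e1, e2, e3, pow_succ (√d)⁻¹]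
    nlinarith [mul_le_mul_of_nonneg_left hu h3, mul_le_mul_of_nonneg_left hd h4]
  have := mul_le_mul_of_nonneg_left h5 (by positivity : 0 ≤ 2 * K)
  linarith

lemma growthError_mono {K e₀ : ℝ} (hK : 0 ≤ K) (hd : 4 ≤ d) {r s : ℕ} (hrs : r ≤ s) :
    growthError K e₀ n d r ≤ growthError K e₀ n d s := by
  refine monotone_nat_of_le_succ (fun s => ?_) hrs
  refine le_trans ?_ (growthError_add_le hK hd s)
  have : 0 ≤ 2 * (K * (d ^ (s + 1) / n + (√d)⁻¹ ^ s)) := by positivity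
  linarith

lemma le_growthError_one {K e₀ : ℝ} (hK : 0 ≤ K) (hd : 0 ≤ d) : e₀ ≤ growthError K e₀ n d 1 := by
  unfold growthError
  rw [pow_one, pow_one, add_sub_cancel_right]
  have : 0 ≤ 2 * K * (2 * d / n) := by positivity
  linarith

/-- Growth of the shells from the growth of the first one. -/
lemma Concentrated.shell_growth (hG : Concentrated n p G) (hn : 0 < n) (hp0 : 0 ≤ p) (hp1 : p ≤ 1)
    (hd : n * p = d) (hd4 : 4 ≤ d) (hL : Real.log n ≤ d) {α β e₀ K : ℝ} (hα : 0 < α) (hβ : 0 < β)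
    (hK : 10 * β + 2 + 8 / √(α / 2) ≤ K) (he₀ : 0 ≤ e₀) {t : ℕ} (ht : t ≤ n)
    (hαd : 2 ≤ α * d)
    (hE : growthError K e₀ n d t ≤ 1 / 2)
    (h1 : (1 - e₀) * α * d ≤ ((shell G w 1).ncard : ℝ) ∧
      ((shell G w 1).ncard : ℝ) ≤ (1 + e₀) * β * d) :
    ∀ s, 1 ≤ s → s ≤ t →
      (1 - growthError K e₀ n d s) * α * d ^ s ≤ ((shell G w s).ncard : ℝ) ∧
        ((shell G w s).ncard : ℝ) ≤ (1 + growthError K e₀ n d s) * β * d ^ s := by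
  have hK0 : 0 ≤ K := le_trans (by positivity) hK
  have hd0 : 0 < d := by linarith
  have hn' : (0 : ℝ) < n := by exact_mod_cast hn
  intro s
  induction s using Nat.strong_induction_on with
  | _ s ih =>
  intro hs1 hst
  obtain rfl | ⟨s, rfl⟩ : s = 1 ∨ ∃ r, s = r + 1 + 1 := by
    rcases s with _ | _ | s
    · omega
    · left; rfl
    · right; exact ⟨s, rfl⟩
  · have h2 : e₀ ≤ growthError K e₀ n d 1 := le_growthError_one hK0 hd0.le
    have h3 : 0 ≤ α * d := by positivity
    have h4 : 0 ≤ β * d := by positivity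
    rw [pow_one]
    constructor <;> nlinarith [h1.1, h1.2]
  · set r := s + 1 with hr
    have hEr : ∀ i ≤ t, growthError K e₀ n d i ≤ 1 / 2 := fun i hi =>
      (growthError_mono hK0 hd4 hi).trans hE
    -- The ball size needs all earlier shells, hence the strong induction. The `+ 1` secures `1 ≤
    -- B`.
    have hball := ncard_ball_succ_le (G := G) (w := w) (B := 2 * β + 1) (d := d) (by linarith)
      (by linarith) r fun i hi1 hir => by
        refine (ih i (by omega) hi1 (by omega)).2.trans ?_
        gcongr
        have := hEr i (by omega)
        nlinarith
    obtain ⟨ihl, ihu⟩ := ih r (by omega) (by omega) (by omega)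
    have hstep := hG.next_shell (w := w) hn hp0 hp1 hd hL (s := r) (by omega)
    have hE1 := hEr r (by omega)
    have hE2 := hEr (r + 1) (by omega)
    have hEadd := growthError_add_le (n := n) (e₀ := e₀) hK0 hd4 r
    have hE0 : 0 ≤ growthError K e₀ n d r := by
      exact he₀.trans ((le_growthError_one hK0 hd0.le).trans
        (growthError_mono hK0 hd4 (by omega)))
    set Er := growthError K e₀ n d r
    set m := (shell G w r).ncard
    have hdr : d ≤ d ^ r := le_self_pow₀ (by linarith) (by omega)
    have hm_lo : α / 2 * d ^ r ≤ m := by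
      refine le_trans ?_ ihl
      have : 0 ≤ α * d ^ r := by positivity
      nlinarith
    have hm_hi : (m : ℝ) ≤ 2 * β * d ^ r := by
      refine ihu.trans ?_
      have : 0 ≤ β * d ^ r := by positivity
      nlinarith
    have hm1 : (1 : ℝ) ≤ m := by
      refine le_trans ?_ hm_lo
      nlinarith
    obtain ⟨hu, hl⟩ := hstep (by exact_mod_cast hm1)
    set x := K * (d ^ (r + 1) / n + (√d)⁻¹ ^ r) with hx
    have hx0 : 0 ≤ x := by positivity
    have hv : 8 / √(m : ℝ) ≤ 8 / √(α / 2) * (√d)⁻¹ ^ r := by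
      rw [inv_pow, ← div_eq_mul_inv, div_div]
      refine div_le_div_of_nonneg_left (by norm_num) (by positivity) ?_
      refine Real.le_sqrt_of_sq_le ?_
      rw [mul_pow, Real.sq_sqrt (by positivity), ← pow_mul, mul_comm r, pow_mul,
        Real.sq_sqrt hd0.le]
      exact hm_lo
    have hpm : p * m ≤ 2 * β * (d ^ (r + 1) / n) := by
      have : p = d / n := by rw [← hd]; field_simp
      rw [this, pow_succ]
      calc d / n * m ≤ d / n * (2 * β * d ^ r) := by gcongr
        _ = _ := by ring
    have hbn : ((G.ball w (r + 1 : ℕ)).ncard : ℝ) / n ≤ (8 * β + 2) * (d ^ (r + 1) / n) := by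
      rw [← mul_div_assoc]
      gcongr
      refine hball.trans ?_
      rw [div_le_iff₀ (by linarith)]
      have h5 : 0 < d ^ (r + 1) := by positivity
      have h6 : (8 * β + 2) * d ^ (r + 1) * 1 ≤ (8 * β + 2) * d ^ (r + 1) * (d - 1) := by
        gcongr; linarith
      have h7 : 0 < β * d ^ (r + 1) := by positivity
      linarith
    have hxu : 8 / √(m : ℝ) ≤ x := by
      refine hv.trans ?_
      have h5 : 0 ≤ K * (d ^ (r + 1) / n) := by positivity
      have h6 : 0 ≤ (√d)⁻¹ ^ r := by positivity
      have h7 : 8 / √(α / 2) ≤ K := by linarith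
      have := mul_le_mul_of_nonneg_right h7 h6
      rw [hx]
      linarith
    -- This is where `K` comes from: `8 β + 2` for the ball, `2 β` for `p m`, and `8 / √(α / 2)` for
    -- the fluctuation.
    have hxl : ((G.ball w (r + 1 : ℕ)).ncard : ℝ) / n + p * m + 8 / √(m : ℝ) ≤ x := by
      have h5 : 0 ≤ d ^ (r + 1) / n := by positivity
      have h6 : 0 ≤ (√d)⁻¹ ^ r := by positivity
      have h7 : 0 ≤ 8 / √(α / 2) := by positivity
      have h8 : 8 / √(α / 2) ≤ K := by linarith
      have h9 : 10 * β + 2 ≤ K := by linarith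
      have := mul_le_mul_of_nonneg_right h8 h6
      have := mul_le_mul_of_nonneg_right h9 h5
      rw [hx]
      linarith
    have hdd : d ^ (r + 1) = d ^ r * d := pow_succ d r
    constructor
    · calc (1 - growthError K e₀ n d (r + 1)) * α * d ^ (r + 1)
          ≤ ((1 - Er) * (1 - x)) * α * d ^ (r + 1) := by
            gcongr
            have := mul_nonneg hE0 hx0
            linarith
        _ = d * ((1 - Er) * α * d ^ r) * (1 - x) := by rw [hdd]; ring
        _ ≤ d * m * (1 - x) := by
            -- `2 x` is at most an increment of `growthError`, which stays below `1 / 2`.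
            have : 0 ≤ 1 - x := by linarith
            gcongr
        _ ≤ d * m * (1 - (G.ball w (r + 1 : ℕ)).ncard / n - p * m - 8 / √(m : ℝ)) := by
            exact mul_le_mul_of_nonneg_left (by linarith) (by positivity)
        _ ≤ _ := hl
    · calc ((shell G w (r + 1)).ncard : ℝ) ≤ d * m * (1 + 8 / √(m : ℝ)) := hu
        _ ≤ d * ((1 + Er) * β * d ^ r) * (1 + x) := by gcongr
        _ = ((1 + Er) * (1 + x)) * β * d ^ (r + 1) := by rw [hdd]; ring
        _ ≤ (1 + growthError K e₀ n d (r + 1)) * β * d ^ (r + 1) := by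
            gcongr
            have := mul_le_mul_of_nonneg_right hE1 hx0
            linarith

end Growth

/-! ### Degree bounds and growth up to the exponent `t` -/

section FirstShell

variable {c : ℝ} {d : ℕ → ℝ} {t : ℕ → ℕ}

/-- `c log n ≤ d ≤ log ^ 5 n` for all large `n`. -/
def DegreeRange (c : ℝ) (d : ℕ → ℝ) : Prop :=
  ∀ᶠ n : ℕ in atTop, c * Real.log n ≤ d n ∧ d n ≤ Real.log n ^ 5

lemma tendsto_log_pow_div (k : ℕ) :
    Tendsto (fun n : ℕ => Real.log n ^ k / (n : ℝ)) atTop (𝓝 0) :=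
  ((Real.isLittleO_pow_log_id_atTop (n := k)).tendsto_div_nhds_zero).comp
    tendsto_natCast_atTop_atTop

lemma DegreeRange.log_le (hd : DegreeRange c d) (hc : 1 < c) :
    ∀ᶠ n : ℕ in atTop, Real.log n ≤ d n := by
  filter_upwards [hd] with n hn
  have := Real.log_natCast_nonneg n
  nlinarith [hn.1]

lemma DegreeRange.tendsto (hd : DegreeRange c d) (hc : 1 < c) : Tendsto d atTop atTop :=
  tendsto_atTop_mono' _ (hd.log_le hc) (Real.tendsto_log_atTop.comp tendsto_natCast_atTop_atTop)

lemma DegreeRange.tendsto_div (hd : DegreeRange c d) (hc : 1 < c) :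
    Tendsto (fun n : ℕ => d n / n) atTop (𝓝 0) := by
  refine squeeze_zero' ?_ ?_ (tendsto_log_pow_div 5)
  · filter_upwards [(hd.tendsto hc).eventually_ge_atTop 0] with n hn
    positivity
  · filter_upwards [hd] with n hn
    gcongr
    exact hn.2

lemma DegreeRange.edgeProb_eq (hd : DegreeRange c d) (hc : 1 < c) :
    ∀ᶠ n : ℕ in atTop, (edgeProb (d n / n) : ℝ) = d n / n := by
  filter_upwards [(hd.tendsto hc).eventually_ge_atTop 0,
    (hd.tendsto_div hc).eventually_le_const zero_lt_one] with n hn hn1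
  exact congrArg Subtype.val
    (Set.projIcc_of_mem zero_le_one (show d n / n ∈ Set.Icc (0 : ℝ) 1 from ⟨by positivity, hn1⟩))

/-- The bounds on the degrees, with factors `1 ± o(1)`. -/
def FirstShell (α β : ℝ) (d : ℕ → ℝ) : Prop :=
  ∀ ε : ℝ, 0 < ε → WHP d fun n G => ∀ w : Fin n,
    (1 - ε) * α * d n ≤ ((shell G w 1).ncard : ℝ) ∧
      ((shell G w 1).ncard : ℝ) ≤ (1 + ε) * β * d n

lemma Concentrated.first_shell {n : ℕ} {p : ℝ} {G : SimpleGraph (Fin n)} (hG : Concentrated n p G)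
    (w : Fin n) : |((shell G w 1).ncard : ℝ) - (n - 1) * p| ≤
      4 * (√((n - 1) * p * Real.log n) + Real.log n) := by
  have h := hG w 0 (Nat.zero_le n)
  have h1 : meanNext n p (G.ball w (0 : ℕ)).ncard (shell G w 0).ncard = (n - 1) * p := by
    simp [meanNext, shell_zero]
  rwa [h1] at h

lemma firstShell_one (hd : DegreeRange c d) (hc : 1 < c)
    (h : (fun n : ℕ => Real.log n) =o[atTop] d) : FirstShell 1 1 d := by
  intro ε hε
  refine (whp_concentrated d).mono ?_
  -- With `log n ≤ δ² d` the fluctuation is at most `4 (δ d + δ² d) ≤ 8 δ d`; the ninth `δ d` pays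
  -- for `n - 1` in place of `n`.
  set δ := min ε 1 / 9 with hδ
  have hδ0 : 0 < δ := by positivity
  have hδ1 : δ ≤ 1 := by linarith [min_le_right ε 1]
  have hδε : 9 * δ ≤ ε := by linarith [min_le_left ε 1]
  filter_upwards [h.bound (by positivity : 0 < δ ^ 2), hd.edgeProb_eq hc,
    (hd.tendsto hc).eventually_ge_atTop 0, eventually_ge_atTop 1,
    (tendsto_one_div_atTop_nhds_zero_nat (𝕜 := ℝ)).eventually_le_const hδ0]
    with n h1 h2 h3 hn h4 G hG w
  have h5 := hG.first_shell w
  have hn' : (1 : ℝ) ≤ n := by exact_mod_cast hn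
  have hL0 : 0 ≤ Real.log n := Real.log_natCast_nonneg n
  rw [h2] at h5
  rw [Real.norm_of_nonneg hL0, Real.norm_of_nonneg h3] at h1
  have e1 : ((n : ℝ) - 1) * (d n / n) = d n - d n * (1 / n) := by field_simp
  have e2 : d n * (1 / n) ≤ d n * δ := mul_le_mul_of_nonneg_left h4 h3
  have e3 : 0 ≤ d n * (1 / n) := by positivity
  rw [e1] at h5
  have e4 : √((d n - d n * (1 / n)) * Real.log n) ≤ δ * d n := by
    rw [Real.sqrt_le_left (by positivity)]
    calc (d n - d n * (1 / n)) * Real.log n ≤ d n * (δ ^ 2 * d n) :=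
          mul_le_mul (by linarith) h1 hL0 h3
      _ = (δ * d n) ^ 2 := by ring
  have e5 : δ ^ 2 * d n ≤ δ * d n := by
    refine mul_le_mul_of_nonneg_right ?_ h3
    nlinarith
  have e6 := mul_le_mul_of_nonneg_right hδε h3
  obtain ⟨h6, h7⟩ := abs_le.1 h5
  constructor <;> linarith

/-- For `l = -log η` and threshold `(η / l) d`, the lower-tail exponent is at most `-(1 - 3 η) d ≤
-c (1 - 3 η) log n`. The choice of `η` makes `c (1 - 3 η) = (c + 1) / 2 > 1`, so the union over `n`
vertices leaves `n ^ (-(c - 1) / 2)`. The upper constant 9 is the mean `d` plus a fluctuation of at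
most `8 d`. -/
lemma exists_firstShell (hc : 1 < c) :
    ∃ α : ℝ, 0 < α ∧ ∀ d, DegreeRange c d → FirstShell α 9 d := by
  set η : ℝ := (c - 1) / (6 * c) with hη
  have hc0 : 0 < c := by linarith
  have hη0 : 0 < η := div_pos (by linarith) (by linarith)
  have hcη : c * (1 - 3 * η) = (c + 1) / 2 := by rw [hη]; field_simp; ring
  have hη1 : η < 1 := by rw [hη, div_lt_one (by linarith)]; linarith
  have hl : 0 < -Real.log η := neg_pos.2 (Real.log_neg hη0 hη1)
  set l := -Real.log η with hl_def
  have hexp : Real.exp (-l) = η := by rw [hl_def, neg_neg, Real.exp_log hη0]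
  refine ⟨η / l, by positivity, fun d hd => ?_⟩
  have hlow : WHP d fun n G => ∀ w : Fin n, η / l * d n ≤ ((shell G w 1).ncard : ℝ) := by
    have hlim : Tendsto (fun n : ℕ => Real.exp (-((c - 1) / 2 * Real.log n))) atTop (𝓝 0) :=
      Real.tendsto_exp_neg_atTop_nhds_zero.comp
        ((Real.tendsto_log_atTop.comp tendsto_natCast_atTop_atTop).const_mul_atTop (by linarith))
    refine WHP.of_compl_le hlim ?_
    filter_upwards [hd, hd.edgeProb_eq hc, (hd.tendsto hc).eventually_ge_atTop 0,
      eventually_ge_atTop 1, (tendsto_one_div_atTop_nhds_zero_nat (𝕜 := ℝ)).eventually_le_const hη0]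
      with n h1 h2 h3 hn h4
    have hn0 : (0 : ℝ) < n := by exact_mod_cast hn
    have hL0 : 0 ≤ Real.log n := Real.log_natCast_nonneg n
    have hsub : {G : SimpleGraph (Fin n) | ¬ ∀ w : Fin n, η / l * d n ≤ ((shell G w 1).ncard : ℝ)} ⊆
        ⋃ w : Fin n, {G | ((shell G w 1).ncard : ℝ) ≤ η / l * d n} := by
      intro G hG
      simp only [Set.mem_ofPred_eq, not_forall, not_le] at hG
      obtain ⟨w, hw⟩ := hG
      exact Set.mem_iUnion.2 ⟨w, hw.le⟩
    refine (measureReal_mono hsub).trans ((measureReal_iUnion_fintype_le _).trans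
      ((Finset.sum_le_card_nsmul _ _ _ fun w _ =>
        measureReal_shell_one_le _ w (η / l * d n) hl.le).trans ?_))
    rw [Finset.card_univ, Fintype.card_fin, nsmul_eq_mul, h2, hexp]
    have e2 : ((n : ℝ) - 1) * (d n / n) * (η - 1) + l * (η / l * d n) =
        d n * (2 * η - 1) + d n * (1 / n) * (1 - η) := by field_simp; ring
    rw [e2]
    have e3 : d n * (1 / n) * (1 - η) ≤ d n * η := by
      have := mul_le_mul_of_nonneg_left h4 h3
      have h0 : 0 ≤ d n * (1 / n) * η := by positivity
      linarith
    have e4 : c * Real.log n * (1 - 3 * η) ≤ d n * (1 - 3 * η) := by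
      refine mul_le_mul_of_nonneg_right h1.1 ?_
      by_contra hneg
      have := mul_neg_of_pos_of_neg hc0 (not_le.1 hneg)
      linarith
    have e5 : c * Real.log n * (1 - 3 * η) = (c + 1) / 2 * Real.log n := by rw [← hcη]; ring
    calc (n : ℝ) * Real.exp (d n * (2 * η - 1) + d n * (1 / n) * (1 - η))
        = Real.exp (Real.log n + (d n * (2 * η - 1) + d n * (1 / n) * (1 - η))) := by
          rw [Real.exp_add (Real.log n), Real.exp_log hn0]
      _ ≤ _ := by
          rw [Real.exp_le_exp]
          linarith
  have hup : WHP d fun n G => ∀ w : Fin n, ((shell G w 1).ncard : ℝ) ≤ 9 * d n := by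
    refine (whp_concentrated d).mono ?_
    filter_upwards [hd.log_le hc, hd.edgeProb_eq hc, (hd.tendsto hc).eventually_ge_atTop 0,
      eventually_ge_atTop 1] with n h1 h2 h3 hn G hG w
    have h5 := (abs_le.1 (hG.first_shell w)).2
    have hn' : (1 : ℝ) ≤ n := by exact_mod_cast hn
    rw [h2] at h5
    have hL0 : 0 ≤ Real.log n := Real.log_natCast_nonneg n
    have e1 : ((n : ℝ) - 1) * (d n / n) ≤ d n := by
      rw [show ((n : ℝ) - 1) * (d n / n) = d n - d n * (1 / n) by field_simp]
      have : 0 ≤ d n * (1 / n) := by positivity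
      linarith
    have e2 : √(((n : ℝ) - 1) * (d n / n) * Real.log n) ≤ d n := by
      rw [Real.sqrt_le_left h3, sq]
      exact mul_le_mul e1 h1 hL0 h3
    linarith
  intro ε hε
  refine (hlow.and hup).mono ?_
  filter_upwards [(hd.tendsto hc).eventually_ge_atTop 0] with n h3 G hG w
  have e1 : 0 ≤ η / l * d n := by positivity
  have e2 : 0 ≤ ε * (η / l * d n) := by positivity
  have e3 : 0 ≤ ε * d n := by positivity
  have := hG.1 w
  have := hG.2 w
  constructor <;> linarith

/-- `t < 2 ^ t ≤ d ^ t ≤ n`. This keeps the radii `t` and `t + 1` within the range covered by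
`Concentrated`. -/
lemma eventually_exponent_le (hd : Tendsto d atTop atTop)
    (ht : (fun n : ℕ => d n ^ t n) =o[atTop] fun n : ℕ => (n : ℝ)) :
    ∀ᶠ n : ℕ in atTop, t n + 1 ≤ n := by
  filter_upwards [hd.eventually_ge_atTop 2, ht.bound zero_lt_one] with n h1 h2
  have h3 : (2 : ℝ) ^ t n ≤ d n ^ t n := pow_le_pow_left₀ (by norm_num) h1 _
  rw [one_mul, Real.norm_of_nonneg (by positivity), Real.norm_of_nonneg (by positivity)] at h2
  have h4 : 2 ^ t n ≤ n := by exact_mod_cast h3.trans h2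
  exact Nat.lt_two_pow_self.trans_le h4

lemma tendsto_growthError (K e₀ : ℝ) (hd : Tendsto d atTop atTop)
    (ht : (fun n : ℕ => d n ^ t n) =o[atTop] fun n : ℕ => (n : ℝ)) :
    Tendsto (fun n => e₀ + 2 * K * (2 * (d n ^ t n / n) + 2 * (√(d n))⁻¹)) atTop (𝓝 e₀) := by
  have h1 := (ht.tendsto_div_nhds_zero).const_mul 2
  have h2 : Tendsto (fun n => 2 * (√(d n))⁻¹) atTop (𝓝 (2 * 0)) :=
    ((Real.tendsto_sqrt_atTop.comp hd).inv_tendsto_atTop).const_mul 2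
  have h3 := ((h1.add h2).const_mul (2 * K)).const_add e₀
  simpa using h3

/-- The growth of all shells follows from that of the first one. -/
lemma FirstShell.shellGrowth {α β : ℝ} (hα : 0 < α) (hβ : 0 < β) (hd : DegreeRange c d)
    (hc : 1 < c) (ht : (fun n : ℕ => d n ^ t n) =o[atTop] fun n : ℕ => (n : ℝ))
    (h : FirstShell α β d) : ShellGrowth α β d t := by
  intro ε hε
  -- Half of the allowance goes to the first shell and half to later steps; the cap `1 / 2` is
  -- required by `Concentrated.shell_growth`.
  set e₀ := min ε (1 / 2) / 2 with he₀
  have hmin : 0 < min ε (1 / 2) := by positivity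
  have he0 : 0 < e₀ := by positivity
  have he1 : e₀ < min ε (1 / 2) := by rw [he₀]; linarith
  refine ((h e₀ he0).and (whp_concentrated d)).mono ?_
  set K := 10 * β + 2 + 8 / √(α / 2) with hK
  have hK0 : 0 ≤ K := by positivity
  have hdt := hd.tendsto hc
  filter_upwards [hdt.eventually_ge_atTop 4, hd.edgeProb_eq hc, hd.log_le hc,
    eventually_exponent_le hdt ht, hdt.eventually_ge_atTop (2 / α), eventually_ge_atTop 1,
    (tendsto_growthError K e₀ hdt ht).eventually_le_const he1] with n h1 h2 h3 h4 h5 hn h6 G hG w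
  rintro s hs1 hst
  have hn' : (0 : ℝ) < n := by exact_mod_cast hn
  have hE : growthError K e₀ n (d n) (t n) ≤ min ε (1 / 2) := by
    refine le_trans ?_ h6
    have : 0 ≤ 2 * K * (2 * (√(d n))⁻¹ ^ t n) := by positivity
    unfold growthError
    rw [mul_div_assoc]
    linarith
  have hp := (edgeProb (d n / n)).2
  have hg := hG.2.shell_growth (w := w) hn hp.1 hp.2 (by rw [h2]; field_simp) h1 h3 hα hβ le_rfl
    he0.le (t := t n) (by omega) (by rwa [div_le_iff₀' hα] at h5) (hE.trans (min_le_right _ _))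
    (hG.1 w) s hs1 hst
  have hEs : growthError K e₀ n (d n) s ≤ ε :=
    (growthError_mono hK0 h1 hst).trans (hE.trans (min_le_left _ _))
  constructor
  · refine le_trans ?_ hg.1
    gcongr
  · refine hg.2.trans ?_
    gcongr

end FirstShell

/-! ### The last shells for `γ = Θ(1)` and `γ → ∞` -/

section LastShells

variable {n : ℕ} {p : ℝ} {G : SimpleGraph (Fin n)} {w : Fin n}

/-- The fluctuation of a shell, as a fraction of all vertices. -/
noncomputable def fluctuation (n : ℕ) : ℝ :=
  4 * (√(n * Real.log n) + Real.log n) / n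

lemma Concentrated.abs_sub_le (hG : Concentrated n p G) (hp0 : 0 ≤ p) (hp1 : p ≤ 1) (hn : 0 < n)
    {s : ℕ} (hs : s ≤ n) :
    |shellFraction G w (s + 1) - meanNext n p (G.ball w s).ncard (shell G w s).ncard / n| ≤
      fluctuation n := by
  have hn' : (0 : ℝ) < n := by exact_mod_cast hn
  have hL0 : 0 ≤ Real.log n := Real.log_natCast_nonneg n
  rw [shellFraction, ← sub_div, abs_div, abs_of_pos hn', fluctuation]
  gcongr
  refine (hG w s hs).trans ?_
  gcongr
  exact meanNext_le_card hp0 hp1 _ _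

/-- With `b` the explored fraction and `x = p m`, the mean is at least `(1 - b)(1 - exp (-x)) ≥ 1 -
b - exp (-x)`. -/
lemma Concentrated.le_shellFraction (hG : Concentrated n p G) (hp0 : 0 ≤ p) (hp1 : p ≤ 1)
    (hn : 0 < n) {s : ℕ} (hs : s ≤ n) :
    1 - (G.ball w (s + 1 : ℕ)).ncard / n - Real.exp (-(p * (shell G w s).ncard)) - fluctuation n ≤
      shellFraction G w (s + 1) := by
  have h := (abs_le.1 (hG.abs_sub_le (w := w) hp0 hp1 hn hs)).1
  have hn' : (0 : ℝ) < n := by exact_mod_cast hn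
  have ham : ((G.ball w (s + 1 : ℕ)).ncard : ℝ) ≤ n := by exact_mod_cast ncard_le_card _
  have h1 : 1 - ((G.ball w (s + 1 : ℕ)).ncard : ℝ) / n - Real.exp (-(p * (shell G w s).ncard)) ≤
      meanNext n p (G.ball w s).ncard (shell G w s).ncard / n := by
    have h2 := one_sub_pow_le_exp hp1 (shell G w s).ncard
    have h3 : 0 ≤ Real.exp (-(p * (shell G w s).ncard)) := (Real.exp_pos _).le
    have h4 : 0 ≤ ((G.ball w (s + 1 : ℕ)).ncard : ℝ) / n := by positivity
    have h5 : ((G.ball w (s + 1 : ℕ)).ncard : ℝ) / n ≤ 1 := (div_le_one hn').2 ham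
    have h6 : meanNext n p (G.ball w s).ncard (shell G w s).ncard / n =
        (1 - ((G.ball w (s + 1 : ℕ)).ncard : ℝ) / n) * (1 - (1 - p) ^ (shell G w s).ncard) := by
      rw [meanNext, ncard_ball_succ]
      push_cast; field_simp; ring
    rw [h6]
    have h7 := mul_le_mul_of_nonneg_left h2 (sub_nonneg.2 h5)
    have h8 := mul_nonneg h4 h3
    linarith
  linarith

/-- From `1 / (1 - p) = 1 + p / (1 - p) ≤ exp (p / (1 - p))` one gets a lower bound for `(1 - p) ^
m`. -/
lemma Concentrated.shellFraction_le (hG : Concentrated n p G) (hp0 : 0 ≤ p) (hp1 : p < 1)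
    (hn : 0 < n) {s : ℕ} (hs : s ≤ n) :
    shellFraction G w (s + 1) ≤
      1 - Real.exp (-(p * (shell G w s).ncard / (1 - p))) + fluctuation n := by
  have h := (abs_le.1 (hG.abs_sub_le (w := w) hp0 hp1.le hn hs)).2
  have hn' : (0 : ℝ) < n := by exact_mod_cast hn
  have h1 : meanNext n p (G.ball w s).ncard (shell G w s).ncard / n ≤
      1 - Real.exp (-(p * (shell G w s).ncard / (1 - p))) := by
    have h2 : Real.exp (-(p * (shell G w s).ncard / (1 - p))) ≤ (1 - p) ^ (shell G w s).ncard := by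
      rw [show -(p * ((shell G w s).ncard : ℝ) / (1 - p)) = (shell G w s).ncard * (-(p / (1 - p)))
        by ring, Real.exp_nat_mul]
      refine pow_le_pow_left₀ (Real.exp_pos _).le ?_ _
      have hp : 0 < 1 - p := by linarith
      rw [Real.exp_neg]
      refine inv_le_of_inv_le₀ hp ?_
      refine le_trans (le_of_eq ?_) (Real.add_one_le_exp _)
      field_simp; ring
    have h3 : (1 - p) ^ (shell G w s).ncard ≤ 1 := pow_le_one₀ (by linarith) (by linarith)
    rw [div_le_iff₀ hn', meanNext]
    have h4 : (0 : ℝ) ≤ (G.ball w s).ncard := Nat.cast_nonneg _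
    have h5 : (0 : ℝ) ≤ (shell G w s).ncard := Nat.cast_nonneg _
    calc _ ≤ (n : ℝ) * (1 - (1 - p) ^ (shell G w s).ncard) :=
          mul_le_mul_of_nonneg_right (by linarith) (by linarith)
      _ ≤ n * (1 - Real.exp (-(p * (shell G w s).ncard / (1 - p)))) :=
          mul_le_mul_of_nonneg_left (by linarith) hn'.le
      _ = _ := mul_comm _ _
  linarith

lemma shellFraction_add_le_one (hn : 0 < n) (s : ℕ) :
    shellFraction G w s + shellFraction G w (s + 1) ≤ 1 := by
  have hn' : (0 : ℝ) < n := by exact_mod_cast hn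
  rw [shellFraction, shellFraction, ← add_div, div_le_one hn']
  have h := ncard_le_card (G.ball w (s + 1 + 1 : ℕ))
  rw [ncard_ball_succ, ncard_ball_succ] at h
  exact_mod_cast (by omega : (shell G w s).ncard + (shell G w (s + 1)).ncard ≤ n)

/-- The Lipschitz bound turns a small relative error in a bounded exponent into an additive error.
-/
lemma exp_neg_le_exp_neg_add {a b : ℝ} (ha : 0 ≤ a) (hab : a ≤ b) :
    Real.exp (-a) ≤ Real.exp (-b) + (b - a) := by
  have h1 : Real.exp (-b) = Real.exp (-a) * Real.exp (-(b - a)) := by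
    rw [← Real.exp_add]; ring_nf
  have h2 := Real.add_one_le_exp (-(b - a))
  have h3 : Real.exp (-a) ≤ 1 := Real.exp_le_one_iff.2 (by linarith)
  have h4 := mul_le_mul_of_nonneg_left h2 (Real.exp_pos (-a)).le
  have h5 := mul_le_mul_of_nonneg_right h3 (sub_nonneg.2 hab)
  rw [h1]
  linarith

/-- The bound `d ≤ log ^ 5 n` enters here: the fluctuation is `o(1 / d)`, hence negligible against
`βγ / d`. -/
lemma tendsto_fluctuation_mul :
    Tendsto (fun n : ℕ => fluctuation n * Real.log n ^ 5) atTop (𝓝 0) := by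
  have h1 : Tendsto (fun n : ℕ => √(Real.log n ^ 11 / n)) atTop (𝓝 0) := by
    simpa using (tendsto_log_pow_div 11).sqrt
  have h2 := ((h1.add (tendsto_log_pow_div 6)).const_mul 4)
  rw [add_zero, mul_zero] at h2
  refine h2.congr' ?_
  filter_upwards [eventually_ge_atTop 1] with n hn
  have hn' : (0 : ℝ) < n := by exact_mod_cast hn
  have hL0 : 0 ≤ Real.log n := Real.log_natCast_nonneg n
  have h3 : √(Real.log n ^ 11 / n) = √(n * Real.log n) * Real.log n ^ 5 / n := by
    rw [show Real.log n ^ 11 / n = (n * Real.log n) * (Real.log n ^ 5 / n) ^ 2 by field_simp,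
      Real.sqrt_mul (by positivity), Real.sqrt_sq (by positivity), mul_div_assoc]
  rw [h3, fluctuation]
  field_simp

lemma fluctuation_nonneg (n : ℕ) : 0 ≤ fluctuation n := by
  have hL0 : 0 ≤ Real.log n := Real.log_natCast_nonneg n
  unfold fluctuation
  positivity

lemma tendsto_fluctuation : Tendsto fluctuation atTop (𝓝 0) := by
  refine squeeze_zero' (Eventually.of_forall fluctuation_nonneg) ?_ tendsto_fluctuation_mul
  filter_upwards [(Real.tendsto_log_atTop.comp tendsto_natCast_atTop_atTop).eventually_ge_atTop 1]
    with n hn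
  exact le_mul_of_one_le_right (fluctuation_nonneg n) (one_le_pow₀ hn)

variable {c : ℝ} {d : ℕ → ℝ} {t : ℕ → ℕ} {α β : ℝ}

lemma gam_eq (d : ℕ → ℝ) (t : ℕ → ℕ) (n : ℕ) : gam d t n = d n / n * d n ^ t n := by
  rw [gam, pow_succ]; ring

/-- The exponent is positive once `γ` is bounded below. -/
lemma eventually_one_le_exponent (hd : DegreeRange c d) (hc : 1 < c) {g : ℝ} (hg : 0 < g)
    (hγ : ∀ᶠ n in atTop, g ≤ gam d t n) : ∀ᶠ n in atTop, 1 ≤ t n := by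
  filter_upwards [hγ, (hd.tendsto_div hc).eventually_lt_const hg] with n h1 h2
  by_contra h
  have h0 : t n = 0 := by omega
  rw [gam_eq, h0, pow_zero, mul_one] at h1
  linarith

/-- If `γ → ∞` then `V_{t+1}(w)` misses only a small fraction of the vertices. -/
lemma ShellGrowth.oneLastShell {α' : ℝ} (hα : 0 < α) (hαα' : α < α') (hβ : 1 ≤ β)
    (hd : DegreeRange c d) (hc : 1 < c)
    (ht : (fun n : ℕ => d n ^ t n) =o[atTop] fun n : ℕ => (n : ℝ))
    (hγ : Tendsto (gam d t) atTop atTop) (h : ShellGrowth α' β d t) : OneLastShell α β d t := by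
  intro ε hε
  -- The first entry gives `α ≤ (1 - δ) α'`. As `γ` is unbounded, a relative error in the exponent
  -- cannot be absorbed by a factor `1 + ε`, so the gap between `α` and `α'` pays for it. The other
  -- entries give `(1 + δ)² ≤ 1 + ε / 2`.
  set δ := min (1 - α / α') (min (ε / 8) 1) with hδ
  have hα' : 0 < α' := hα.trans hαα'
  have hδ0 : 0 < δ := by
    have : 0 < 1 - α / α' := sub_pos.2 ((div_lt_one hα').2 hαα')
    positivity
  have hδα : α ≤ (1 - δ) * α' := by
    have : α / α' ≤ 1 - δ := by linarith [min_le_left (1 - α / α') (min (ε / 8) 1)]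
    rwa [div_le_iff₀ hα'] at this
  have hδε : δ ≤ ε / 8 := (min_le_right _ _).trans (min_le_left _ _)
  have hδ1 : δ ≤ 1 := (min_le_right _ _).trans (min_le_right _ _)
  refine ((h δ hδ0).and (whp_concentrated d)).mono ?_
  have hdt := hd.tendsto hc
  filter_upwards [hdt.eventually_ge_atTop 2, hdt.eventually_ge_atTop (1 / δ + 1), hd,
    hd.edgeProb_eq hc, eventually_exponent_le hdt ht, hγ.eventually_ge_atTop 1,
    eventually_one_le_exponent hd hc zero_lt_one (hγ.eventually_ge_atTop 1),
    tendsto_fluctuation_mul.eventually_le_const (by positivity : 0 < ε / 2),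
    eventually_ge_atTop 1] with n h2 hδd hdn hp ht1 hγ1 htn hfl hn G hG w
  have hn' : (0 : ℝ) < n := by exact_mod_cast hn
  have hd0 : 0 < d n := by linarith
  have hpI := (edgeProb (d n / n)).2
  have hG1 := hG.1 w
  have hmain := hG.2.le_shellFraction (w := w) hpI.1 hpI.2 hn (s := t n) (by omega)
  rw [hp] at hmain
  have hball := ncard_ball_succ_le (G := G) (w := w) (B := (1 + δ) * β) (d := d n) (by nlinarith)
    (by linarith) (t n) fun r hr hrt => (hG1 r hr hrt).2
  have hfl' : fluctuation n ≤ ε / 2 * (β * gam d t n / d n) := by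
    rw [mul_div_assoc', le_div_iff₀ hd0]
    calc fluctuation n * d n ≤ fluctuation n * Real.log n ^ 5 :=
          mul_le_mul_of_nonneg_left hdn.2 (fluctuation_nonneg n)
      _ ≤ ε / 2 * 1 := by linarith
      _ ≤ ε / 2 * (β * gam d t n) := by
          gcongr
          nlinarith
  have hbn : ((G.ball w (t n + 1 : ℕ)).ncard : ℝ) / n ≤
      (1 + ε / 2) * (β * gam d t n / d n) := by
    have e1 : d n / (d n - 1) ≤ 1 + δ := by
      rw [div_le_iff₀ (by linarith)]
      have : 1 ≤ δ * (d n - 1) := by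
        rw [← div_le_iff₀' hδ0]; linarith
      linarith
    have e2 : (1 + δ) * (1 + δ) ≤ 1 + ε / 2 := by nlinarith
    calc ((G.ball w (t n + 1 : ℕ)).ncard : ℝ) / n
        ≤ ((1 + δ) * β * d n ^ (t n + 1) / (d n - 1)) / n := by gcongr
      _ = (1 + δ) * (d n / (d n - 1)) * (β * gam d t n / d n) := by
          rw [gam]; field_simp
      _ ≤ (1 + δ) * (1 + δ) * (β * gam d t n / d n) := by gcongr
      _ ≤ (1 + ε / 2) * (β * gam d t n / d n) := by gcongr
  have hexp : Real.exp (-(d n / n * (shell G w (t n)).ncard)) ≤ Real.exp (-(α * gam d t n)) := by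
    rw [Real.exp_le_exp, neg_le_neg_iff, gam_eq]
    calc α * (d n / n * d n ^ t n) ≤ (1 - δ) * α' * (d n / n * d n ^ t n) := by gcongr
      _ = d n / n * ((1 - δ) * α' * d n ^ t n) := by ring
      _ ≤ _ := by gcongr; exact (hG1 (t n) htn le_rfl).1
  have h9 : 0 ≤ ε * Real.exp (-(α * gam d t n)) := by positivity
  linarith

/-- The bounds on `V_{t+1}` come from `p |V_t|`. Those on `V_{t+2}` follow by subtraction, once the
two fractions are known to add up to nearly 1. -/
lemma Concentrated.two_last_shells {t : ℕ} {α β γ δ ε' θ d : ℝ} (hG : Concentrated n p G)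
    (hn : 0 < n) (hp0 : 0 ≤ p) (hpd : p ≤ δ / 4) (hd : n * p = d) (ht : t + 1 ≤ n)
    (hδ1 : δ ≤ 1 / 2) (hδ0 : 0 < δ) (hε'θ : ε' ≤ θ) (hαγ : 0 ≤ α * γ) (hβγ : 0 ≤ β * γ)
    (hxlo : (1 - δ) * (α * γ) ≤ p * (shell G w t).ncard)
    (hxhi : p * (shell G w t).ncard ≤ (1 + δ) * (β * γ))
    (hδγ : δ * (α * γ) + δ * (β * γ) ≤ ε' / 8) (hε'0 : 0 < ε')
    (hbn : ((G.ball w (t + 1 : ℕ)).ncard : ℝ) / n ≤ ε' / 8) (hfl : fluctuation n ≤ ε' / 8)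
    (he : Real.exp (-(θ / 2 * d)) ≤ ε' / 8) (hθγ : θ ≤ 1 - Real.exp (-(α * γ))) :
    (1 - Real.exp (-(α * γ)) - ε' ≤ shellFraction G w (t + 1) ∧
      shellFraction G w (t + 1) ≤ 1 - Real.exp (-(β * γ)) + ε') ∧
    (Real.exp (-(β * γ)) - ε' ≤ shellFraction G w (t + 2) ∧
      shellFraction G w (t + 2) ≤ Real.exp (-(α * γ)) + ε') ∧
    |shellFraction G w (t + 1) + shellFraction G w (t + 2) - 1| ≤ ε' := by
  have hn' : (0 : ℝ) < n := by exact_mod_cast hn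
  have hd0 : 0 ≤ d := by rw [← hd]; positivity
  have hlow1 := hG.le_shellFraction (w := w) hp0 (by linarith) hn (s := t) (by omega)
  have hlow2 := hG.le_shellFraction (w := w) hp0 (by linarith) hn (s := t + 1) (by omega)
  have hup1 := hG.shellFraction_le (w := w) hp0 (by linarith) hn (s := t) (by omega)
  have hsum := shellFraction_add_le_one (G := G) (w := w) hn (t + 1)
  rw [ncard_ball_succ _ _ (t + 1)] at hlow2
  set x := p * (shell G w t).ncard with hx
  have hδα0 : 0 ≤ δ * (α * γ) := by positivity
  have hδβ0 : 0 ≤ δ * (β * γ) := by positivity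
  have hexp1 : Real.exp (-x) ≤ Real.exp (-(α * γ)) + ε' / 8 := by
    have e1 : Real.exp (-x) ≤ Real.exp (-((1 - δ) * (α * γ))) :=
      Real.exp_le_exp.2 (neg_le_neg hxlo)
    have e2 := exp_neg_le_exp_neg_add (a := (1 - δ) * (α * γ)) (b := α * γ)
      (mul_nonneg (by linarith) hαγ) (by linarith)
    linarith
  have hexp2 : Real.exp (-(β * γ)) ≤ Real.exp (-(x / (1 - p))) + ε' / 4 := by
    have e1 : x / (1 - p) ≤ (1 + 2 * δ) * (β * γ) := by
      rw [div_le_iff₀ (by linarith)]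
      have e4 : (1 + δ) ≤ (1 + 2 * δ) * (1 - p) := by nlinarith
      calc x ≤ (1 + δ) * (β * γ) := hxhi
        _ ≤ (1 + 2 * δ) * (1 - p) * (β * γ) := by gcongr
        _ = _ := by ring
    have e2 := exp_neg_le_exp_neg_add (a := β * γ) (b := (1 + 2 * δ) * (β * γ)) hβγ
      (by linarith)
    have e5 : Real.exp (-((1 + 2 * δ) * (β * γ))) ≤ Real.exp (-(x / (1 - p))) :=
      Real.exp_le_exp.2 (neg_le_neg e1)
    linarith
  have hlow : 1 - Real.exp (-(α * γ)) - 3 * (ε' / 8) ≤ shellFraction G w (t + 1) := by linarith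
  -- As `ε' ≤ θ`, the shell has linear size, so the next step misses only a fraction of about `exp
  -- (-θ d / 2)`.
  have hfrac : θ / 2 ≤ shellFraction G w (t + 1) := by linarith
  have hpm : θ / 2 * d ≤ p * (shell G w (t + 1)).ncard := by
    calc θ / 2 * d ≤ shellFraction G w (t + 1) * d := by gcongr
      _ = _ := by rw [shellFraction, ← hd]; field_simp
  have hexp3 : Real.exp (-(p * (shell G w (t + 1)).ncard)) ≤ ε' / 8 :=
    (Real.exp_le_exp.2 (neg_le_neg hpm)).trans he
  have hsplit : (((G.ball w (t + 1 : ℕ)).ncard + (shell G w (t + 1)).ncard : ℕ) : ℝ) / n =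
      ((G.ball w (t + 1 : ℕ)).ncard : ℝ) / n + shellFraction G w (t + 1) := by
    rw [shellFraction]; push_cast; ring
  rw [hsplit] at hlow2
  have hsum2 : 1 - 3 * (ε' / 8) ≤ shellFraction G w (t + 1) + shellFraction G w (t + 2) := by
    change _ ≤ _ + shellFraction G w (t + 1 + 1)
    linarith
  change _ + shellFraction G w (t + 2) ≤ 1 at hsum
  refine ⟨⟨by linarith, by linarith⟩, ⟨by linarith, by linarith⟩, ?_⟩
  rw [abs_le]
  constructor <;> linarith

/-- If `γ = Θ(1)` then `V_{t+1}(w)` and `V_{t+2}(w)` cover almost all vertices. -/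
lemma ShellGrowth.twoLastShells (hα : 0 < α) (hβ : 1 ≤ β)
    (hd : DegreeRange c d) (hc : 1 < c)
    (ht : (fun n : ℕ => d n ^ t n) =o[atTop] fun n : ℕ => (n : ℝ))
    (hγ : gam d t =Θ[atTop] fun _ => (1 : ℝ)) (h : ShellGrowth α β d t) :
    TwoLastShells α β d t := by
  intro ε hε
  have hdt := hd.tendsto hc
  have hγ0 : ∀ᶠ n in atTop, 0 ≤ gam d t n := by
    filter_upwards [hdt.eventually_ge_atTop 0] with n hn
    unfold gam; positivity
  obtain ⟨g₁, hg₁, hγ1⟩ : ∃ g₁ : ℝ, 0 < g₁ ∧ ∀ᶠ n in atTop, gam d t n ≤ g₁ := by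
    obtain ⟨g, hg, hb⟩ := hγ.1.exists_pos
    refine ⟨g, hg, ?_⟩
    filter_upwards [hb.bound, hγ0] with n h1 h2
    simpa [Real.norm_of_nonneg h2] using h1
  obtain ⟨g₀, hg₀, hγ2⟩ : ∃ g₀ : ℝ, 0 < g₀ ∧ ∀ᶠ n in atTop, g₀ ≤ gam d t n := by
    obtain ⟨g, hg, hb⟩ := hγ.2.exists_pos
    refine ⟨g⁻¹, by positivity, ?_⟩
    filter_upwards [hb.bound, hγ0] with n h1 h2
    rw [Real.norm_of_nonneg h2, norm_one] at h1
    rwa [inv_le_iff_one_le_mul₀' hg]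
  set θ := 1 - Real.exp (-(α * g₀)) with hθ
  have hθ0 : 0 < θ := by
    have : Real.exp (-(α * g₀)) < 1 := Real.exp_lt_one_iff.2 (by nlinarith [mul_pos hα hg₀])
    linarith
  set ε' := min ε θ with hε'
  have hε'0 : 0 < ε' := by positivity
  have hε'ε : ε' ≤ ε := min_le_left _ _
  have hε'θ : ε' ≤ θ := min_le_right _ _
  -- The upper bound `g₁` on `γ` makes the relative error `δ` cost at most `ε' / 8` in the
  -- exponents.
  set δ := min (ε' / (8 * (α + β) * g₁)) (1 / 2) with hδ
  have hδ0 : 0 < δ := by positivity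
  have hδ1 : δ ≤ 1 / 2 := min_le_right _ _
  have hδε : δ * ((α + β) * g₁) ≤ ε' / 8 := by
    have h1 : δ ≤ ε' / (8 * (α + β) * g₁) := min_le_left _ _
    rw [le_div_iff₀ (by positivity)] at h1
    linarith
  refine ((h δ hδ0).and (whp_concentrated d)).mono ?_
  have hlim1 : Tendsto (fun n => 4 * β * (d n ^ t n / n)) atTop (𝓝 0) := by
    simpa using ht.tendsto_div_nhds_zero.const_mul (4 * β)
  have hlim2 : Tendsto (fun n => Real.exp (-(θ / 2 * d n))) atTop (𝓝 0) :=
    Real.tendsto_exp_neg_atTop_nhds_zero.comp (hdt.const_mul_atTop (by positivity))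
  have hδ4 : 0 < δ / 4 := by positivity
  have hε8 : 0 < ε' / 8 := by positivity
  filter_upwards [hdt.eventually_ge_atTop 2, hd.edgeProb_eq hc, eventually_exponent_le hdt ht,
    hγ0, hγ1, hγ2, eventually_one_le_exponent hd hc hg₀ hγ2,
    tendsto_fluctuation.eventually_le_const hε8, hlim1.eventually_le_const hε8,
    hlim2.eventually_le_const hε8, (hd.tendsto_div hc).eventually_le_const hδ4,
    eventually_ge_atTop 1] with n h2 hp ht1 hγ0 hγ1 hγ2 htn hfl hb he hpd hn G hG w
  have hn' : (0 : ℝ) < n := by exact_mod_cast hn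
  have hd0 : 0 < d n := by linarith
  have hG1 := hG.1 w
  obtain ⟨hlo, hhi⟩ := hG1 (t n) htn le_rfl
  have hball := ncard_ball_succ_le (G := G) (w := w) (B := 2 * β) (d := d n) (by linarith)
    (by linarith) (t n) fun r hr hrt => (hG1 r hr hrt).2.trans (by gcongr; linarith)
  have hbn : ((G.ball w (t n + 1 : ℕ)).ncard : ℝ) / n ≤ ε' / 8 := by
    refine le_trans ?_ hb
    rw [mul_div_assoc']
    gcongr
    refine hball.trans ?_
    rw [div_le_iff₀ (by linarith), pow_succ]
    have : 0 ≤ 2 * β * d n ^ t n := by positivity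
    nlinarith
  have hxlo : (1 - δ) * (α * gam d t n) ≤ d n / n * (shell G w (t n)).ncard := by
    rw [gam_eq]
    calc _ = d n / n * ((1 - δ) * α * d n ^ t n) := by ring
      _ ≤ _ := by gcongr
  have hxhi : d n / n * (shell G w (t n)).ncard ≤ (1 + δ) * (β * gam d t n) := by
    rw [gam_eq]
    calc _ ≤ d n / n * ((1 + δ) * β * d n ^ t n) := by gcongr
      _ = _ := by ring
  have hδγ : δ * (α * gam d t n) + δ * (β * gam d t n) ≤ ε' / 8 := by
    refine le_trans ?_ hδε
    calc _ = δ * ((α + β) * gam d t n) := by ring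
      _ ≤ _ := by gcongr
  have hθγ : θ ≤ 1 - Real.exp (-(α * gam d t n)) := by
    have : Real.exp (-(α * gam d t n)) ≤ Real.exp (-(α * g₀)) := by gcongr
    linarith
  have hconc := hG.2
  rw [hp] at hconc
  obtain ⟨⟨h3, h4⟩, ⟨h5, h6⟩, h7⟩ := hconc.two_last_shells (w := w) hn (by positivity) hpd
    (by field_simp) ht1 hδ1 hδ0 hε'θ (by positivity) (by positivity) hxlo hxhi hδγ hε'0 hbn hfl he
    hθγ
  exact ⟨⟨by linarith, by linarith⟩, ⟨by linarith, by linarith⟩, h7.trans hε'ε⟩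

lemma ShellGrowth.mono {α' : ℝ} (hα : 0 ≤ α) (hαα' : α ≤ α') (hd : DegreeRange c d) (hc : 1 < c)
    (h : ShellGrowth α' β d t) : ShellGrowth α β d t := by
  intro ε hε
  -- Lowering `α'` to `α` weakens the lower bound only if the factor in front is nonnegative, hence
  -- the cap at 1.
  have hε1 : 0 < min ε 1 := by positivity
  refine ((h (min ε 1) hε1).and (h ε hε)).mono ?_
  filter_upwards [(hd.tendsto hc).eventually_ge_atTop 0] with n h0 G hG w s hs hst
  refine ⟨le_trans ?_ (hG.1 w s hs hst).1, (hG.2 w s hs hst).2⟩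
  have h1 : (1 - ε) * α ≤ (1 - min ε 1) * α' :=
    (mul_le_mul_of_nonneg_right (by linarith [min_le_left ε 1]) hα).trans
      (mul_le_mul_of_nonneg_left hαα' (by linarith [min_le_right ε 1]))
  gcongr

end LastShells

end RandomShells

theorem mainTheorem5 (c : ℝ) (hc : 1 < c) :
    ∃ α β : ℝ, 0 < α ∧ α < 1 ∧ 1 < β ∧
      ∀ (d : ℕ → ℝ) (t : ℕ → ℕ),
        (∀ᶠ n : ℕ in atTop, c * Real.log n ≤ d n ∧ d n ≤ Real.log n ^ 5) →
        RandomShells.IsLargestExponent d t →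
          -- the property of `α` and `β` by which they are chosen
          RandomShells.ShellGrowth α β d t ∧
          -- the case `γ = Θ(1)`
          ((RandomShells.gam d t =Θ[atTop] fun _ => (1 : ℝ)) →
            RandomShells.TwoLastShells α β d t) ∧
          -- the case `γ = ω(1)`
          (Tendsto (RandomShells.gam d t) atTop atTop →
            RandomShells.OneLastShell α β d t) ∧
          -- sharper constants when `d = ω(log n)`
          (((fun n : ℕ => Real.log n) =o[atTop] d) →
            RandomShells.ShellGrowth 1 1 d t ∧
            ((RandomShells.gam d t =Θ[atTop] fun _ => (1 : ℝ)) →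
              RandomShells.TwoLastShells 1 1 d t) ∧
            (Tendsto (RandomShells.gam d t) atTop atTop →
              ∀ a : ℝ, 0 < a → a < 1 → RandomShells.OneLastShell a 1 d t)) := by
  open RandomShells in
  obtain ⟨α₀, hα₀, h₀⟩ := exists_firstShell hc
  -- Halving leaves `α` strictly below the constant `α₀` for which growth is proved, the gap that
  -- `ShellGrowth.oneLastShell` requires; the other entry ensures `α < 1`.
  have hα : 0 < min (α₀ / 2) (1 / 2) := by positivity
  have hαα₀ : min (α₀ / 2) (1 / 2) < α₀ := (min_le_left _ _).trans_lt (by linarith)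
  refine ⟨min (α₀ / 2) (1 / 2), 9, hα, (min_le_right _ _).trans_lt (by norm_num), by norm_num,
    fun d t hd ht => ?_⟩
  have hg := (h₀ d hd).shellGrowth hα₀ (by norm_num) hd hc ht.1
  have hg' := hg.mono hα.le hαα₀.le hd hc
  refine ⟨hg', fun hγ => hg'.twoLastShells hα (by norm_num) hd hc ht.1 hγ,
    fun hγ => hg.oneLastShell hα hαα₀ (by norm_num) hd hc ht.1 hγ, fun hlog => ?_⟩
  have hg1 := (firstShell_one hd hc hlog).shellGrowth one_pos one_pos hd hc ht.1
  exact ⟨hg1, fun hγ => hg1.twoLastShells one_pos le_rfl hd hc ht.1 hγ,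
    fun hγ a ha ha1 => hg1.oneLastShell ha ha1 le_rfl hd hc ht.1 hγ⟩
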